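/- **Setting.** Particles occupy nodes of the plane triangular grid $G$, at most one particle per node; each particle occupies one node and does not move. A particle configuration $\mathcal P$ is a finite set of particles; $G_{\mathcal P}$ is the subgraph of $G$ induced by the occupied nodes. A hole of $\mathcal P$ is an interior face of $G_{\mathcal P}$ with more than three vertices; $\mathcal P$ is simply connected if $G_{\mathcal P}$ is connected and $\mathcal P$ has no holes. The diameter of $\mathcal P$ is the graph diameter of $G_{\mathcal P}$. A shortest-path tree (SP-tree) of $\mathcal P$ rooted at $r$ is a spanning tree of $G_{\mathcal P}$, given by a parent for every particle other than $r$, in which the path from every particle to $r$ is a shortest path in $G_{\mathcal P}$. The particles are identical finite-state machines. Each particle numbers its six ports (directions) consecutively modulo $6$, starting from an arbitrary port and clockwise or counter-clockwise; there is no common orientation or chirality. When activated, a particle reads its own memory and the memory of its neighbors, and may write into its own memory and into that of its neighbors; it can translate its own port numbers into those of a neighbor. At every time $t=0,1,2,\dots$ an adversarial scheduler activates an arbitrary set of particles simultaneously; it is fair (at any time, every particle will be activated again later). If several particles write into the same memory simultaneously, the adversary chooses which one of the writes succeeds. A round is a (shortest) time interval in which every particle is activated at least once. **Cone algorithm.**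 Every particle in the tree stores the port of its parent and a cone, i.e. a set of ports. Initially the tree consists of $r$ only, with all six ports in its cone. When a particle $p$ of the tree is activated, it first updates its cone $c$: if $p\ne r$ and the parent of $p$ lies at port $i+3$, then * if $c=[i-1,i]$, the node at port $i+2$ is empty and the node at port $i+1$ is occupied, then $c$ is extended to $[i-1,i+2]$; * if $c=[i,i+1]$, the node at port $i-2$ is empty and the node at port $i-1$ is occupied, then $c$ is extended to $[i-2,i+1]$. Then, for every port $k\in c$ at which there is a neighbor $q$ that is not in the tree yet, $p$ includes $q$ into the tree as a child of $p$, with the cone $c\cap[k-1,k+1]$ translated into the ports of $q$. **Theorem.** There is an absolute constant $C$ such that for every simply connected particle configuration $\mathcal P$ of diameter $d$, every particle $r\in\mathcal P$, all port numberings, every fair scheduler and every resolution of conflicts, after at most $C\,d$ rounds of the cone algorithm started from $r$ the parent pointers form an SP-tree of $\mathcal P$ rooted at $r$, and they do not change afterwards. -/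

import Mathlib

namespace Amoebot

/-! ### The triangular grid and particle configurations -/

/-- Nodes of the triangular grid, in lattice coordinates. -/
abbrev Node := ℤ × ℤ

/-- The six unit vectors of the triangular grid, in counter-clockwise order: direction `i + 1` is
direction `i` turned by 60 degrees. -/
def unitVec : ZMod 6 → Node :=
  ![(1, 0), (0, 1), (-1, 1), (-1, 0), (0, -1), (1, -1)]

/-- The triangular grid `G`. -/
def grid : SimpleGraph Node :=
  SimpleGraph.fromRel fun x y => ∃ i : ZMod 6, y = x + unitVec i

/-- The particles of a configuration whose set of occupied nodes is `P`
(every particle is contracted, i.e. occupies one node). -/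
abbrev Particle (P : Finset Node) := {x : Node // x ∈ P}

/-- `G_P`: the subgraph of the grid induced by the occupied nodes. -/
def particleGraph (P : Finset Node) : SimpleGraph (Particle P) :=
  grid.comap Subtype.val

/-- The unit triangles of the grid: three mutually adjacent nodes. -/
def IsUnitTriangle (T : Finset Node) : Prop := grid.IsNClique 3 T

/-- Two unit triangles share a grid edge `xy` that is not an edge of `G_P`
(some end of it is unoccupied), so that they lie in the same face of `G_P`. -/
def SameFaceStep (P : Finset Node) (T T' : Finset Node) : Prop :=
  IsUnitTriangle T ∧ IsUnitTriangle T' ∧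
    ∃ x y : Node, x ≠ y ∧ x ∈ T ∩ T' ∧ y ∈ T ∩ T' ∧ ¬ (x ∈ P ∧ y ∈ P)

/-- A face of the plane graph `G_P`, given as the set of the unit triangles of the grid that it
consists of: one can move within the face from a triangle to the next one across any grid edge
that is missing in `G_P`. -/
def IsFace (P : Finset Node) (F : Set (Finset Node)) : Prop :=
  ∃ T, IsUnitTriangle T ∧ F = {T' | Relation.ReflTransGen (SameFaceStep P) T T'}

/-- The vertices of `G_P` on a face. -/
def faceVertices (P : Finset Node) (F : Set (Finset Node)) : Set Node :=
  {x | x ∈ P ∧ ∃ T ∈ F, x ∈ T}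

/-- A hole: an interior (bounded) face of `G_P` with more than three vertices. -/
def IsHole (P : Finset Node) (F : Set (Finset Node)) : Prop :=
  IsFace P F ∧ F.Finite ∧ 3 < (faceVertices P F).ncard

/-- A configuration is simply connected if it is connected and has no holes. -/
def SimplyConnected (P : Finset Node) : Prop :=
  (particleGraph P).Connected ∧ ∀ F, ¬ IsHole P F

/-- The particle adjacent to `p` in the global direction `i`, if that node is occupied. -/
def neighbor {P : Finset Node} (p : Particle P) (i : ZMod 6) : Option (Particle P) :=
  if h : p.1 + unitVec i ∈ P then some ⟨p.1 + unitVec i, h⟩ else none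

/-! ### Shortest-path trees -/

/-- The graph formed by the pairs (particle, parent). -/
def treeGraph {P : Finset Node} (parent : Particle P → Option (Particle P)) :
    SimpleGraph (Particle P) :=
  SimpleGraph.fromRel fun p q => parent p = some q

/-- The parent pointers form an SP-tree of `P` rooted at `r`: a spanning tree of `G_P` in which
the path from every particle to `r` is a shortest path in `G_P`. -/
structure IsSPTree (P : Finset Node) (r : Particle P)
    (parent : Particle P → Option (Particle P)) : Prop where
  parent_root : parent r = none
  parent_ne_none : ∀ p, p ≠ r → parent p ≠ none
  subgraph : treeGraph parent ≤ particleGraph P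
  isTree : (treeGraph parent).IsTree
  shortest : ∀ (p : Particle P) (w : (treeGraph parent).Walk p r),
    w.IsPath → w.length = (particleGraph P).dist p r

/-! ### The amoebot model (contracted particles that do not move) -/

/-- The six port identifiers of a contracted particle. -/
abbrev Port := ZMod 6

/-- The port identifiers of one particle: `dir k` is the global direction of port `k`. Ports are
numbered consecutively from an arbitrary first port, counter-clockwise or clockwise. -/
structure PortLabelling where
  dir : Equiv.Perm (ZMod 6)
  ordered : (∀ k, dir (k + 1) = dir k + 1) ∨ (∀ k, dir (k + 1) = dir k - 1)

/-- What an activated particle perceives of a neighbor: the neighbor's memory, and the translation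
of its own ports into the ports of the neighbor that point in the same global direction. -/
abbrev NeighborView (State : Type) := State × (Port ≃ Port)

/-- An algorithm for identical particles with constant memory. On activation a particle reads its
own memory and, through each port, its neighbor there (`none` if the node is empty). It may then
write a new state into its own memory (first component) and into the memory of each neighbor
(second component); `none` means that nothing is written. -/
structure Algorithm where
  State : Type
  finite : Finite State
  act : State → (Port → Option (NeighborView State)) → Option State × (Port → Option State)

/-- The memory contents of all particles. -/
abbrev Memory (A : Algorithm) (P : Finset Node) := Particle P → A.State

section Execution

variable (A : Algorithm) {P : Finset Node} (L : Particle P → PortLabelling)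

/-- What particle `p` perceives through its ports. -/
def view (c : Memory A P) (p : Particle P) : Port → Option (NeighborView A.State) :=
  fun k => (neighbor p ((L p).dir k)).map fun q => (c q, (L p).dir.trans (L q).dir.symm)

/-- When activated with the memory contents `c`, particle `p` attempts to write the state `s` into
the memory of particle `q`. -/
def Writes (c : Memory A P) (p q : Particle P) (s : A.State) : Prop :=
  (p = q ∧ (A.act (c p) (view A L c p)).1 = some s) ∨
    ∃ k : Port, neighbor p ((L p).dir k) = some q ∧ (A.act (c p) (view A L c p)).2 k = some s

/-- One moment of time: all particles in `S` are active simultaneously. If several of them write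
into the same memory, then exactly one write, chosen arbitrarily, succeeds. -/
def Step (S : Set (Particle P)) (c c' : Memory A P) : Prop :=
  ∀ q, (∃ p ∈ S, Writes A L c p q (c' q)) ∨
    ((∀ p ∈ S, ∀ s, ¬ Writes A L c p q s) ∧ c' q = c q)

/-- A run of the algorithm from the memory contents `c₀` when, for every `t`, the scheduler
activates the particles of the set `active t` at time `t`. -/
def IsRun (active : ℕ → Set (Particle P)) (c₀ : Memory A P) (c : ℕ → Memory A P) : Prop :=
  c 0 = c₀ ∧ ∀ t, Step A L (active t) (c t) (c (t + 1))

end Execution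

/-- A fair scheduler: at any moment, every particle is activated at some later moment. -/
def Fair {P : Finset Node} (active : ℕ → Set (Particle P)) : Prop :=
  ∀ t p, ∃ t', t < t' ∧ p ∈ active t'

/-- The moment at which the first `k` rounds are over; the next round is the shortest time interval
from then on in which every particle has been activated at least once. -/
noncomputable def roundEnd {P : Finset Node} (active : ℕ → Set (Particle P)) : ℕ → ℕ
  | 0 => 0
  | k + 1 => sInf {t | ∀ p, ∃ s, roundEnd active k ≤ s ∧ s < t ∧ p ∈ active s}

/-! ### The cone algorithm -/

/-- Memory of a particle in the tree: the port of its parent (`none` for the root) and its cone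
of growth directions, a set of ports. -/
abbrev TreeMemory := Option Port × Finset Port

/-- The cone from which an activated particle of the tree grows; `occ k` says whether there is a
particle at port `k`. Let the parent lie at port `i + 3`. If the cone is `[i - 1, i]`, the node at
`i + 2` is empty and the node at `i + 1` is not, then the cone is extended to `[i - 1, i + 2]`;
symmetrically if the cone is `[i, i + 1]`. -/
def extendedCone (m : TreeMemory) (occ : Port → Bool) : Finset Port :=
  match m.1 with
  | none => m.2
  | some b =>
    let i : Port := b - 3
    if m.2 = {i - 1, i} ∧ occ (i + 2) = false ∧ occ (i + 1) = true then
      {i - 1, i, i + 1, i + 2}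
    else if m.2 = {i, i + 1} ∧ occ (i - 2) = false ∧ occ (i - 1) = true then
      {i - 2, i - 1, i, i + 1}
    else m.2

/-- The memory given to a particle that is included in the tree through port `k` of its parent,
when the parent has the cone `cone`: the intersection of `cone` with `[k - 1, k + 1]`, translated
by `tr` into ports of the new particle, whose parent lies in the direction opposite to `k`. -/
def childMemory (cone : Finset Port) (k : Port) (tr : Port ≃ Port) : TreeMemory :=
  (some (tr (k + 3)), (cone ∩ {k - 1, k, k + 1}).image tr)

/-- The cone algorithm. The state `none` means: not in the tree. An activated particle of the tree
updates its cone and includes every neighbor within its cone that is not in the tree yet. -/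
def coneAlgorithm : Algorithm where
  State := Option TreeMemory
  finite := inferInstance
  act s v :=
    match s with
    | none => (none, fun _ => none)
    | some m =>
      let cone := extendedCone m fun k => (v k).isSome
      (some (some (m.1, cone)),
        fun k =>
          match v k with
          | some (none, tr) => if k ∈ cone then some (some (childMemory cone k tr)) else none
          | _ => none)

/-- Initially the tree consists of the root `r` alone, whose cone contains all six ports. -/
def initialMemory {P : Finset Node} (r : Particle P) : Memory coneAlgorithm P :=
  fun p => if p = r then some (none, Finset.univ) else none

/-- The parent pointers stored in the memory of the particles. -/
def parentOf {P : Finset Node} (L : Particle P → PortLabelling) (c : Memory coneAlgorithm P)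
    (p : Particle P) : Option (Particle P) :=
  match c p with
  | some (some b, _) => neighbor p ((L p).dir b)
  | _ => none

end Amoebot

namespace Amoebot

/-! ### Arithmetic of the unit vectors -/

/-! Let d be the distance to the root. If every particle of the tree grows towards exactly those
neighbors that are farther from the root, then each parent pointer lowers d by one, and a particle
at distance k + 1 is in the tree once a neighbor at distance k has been activated in round k + 1. So
the point is that the cone, a purely local datum, knows where d increases.

This rests on `up_iff`: without holes, the directions towards the root determine those away from it.
It combines two facts: directions towards the root are pairwise adjacent (`down_adjacent`), and
adjacent nodes with equal d have a common neighbor closer to the root (`down_of_eq`). Both come from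
portals, the segments of occupied nodes along an axis. Intuitively the portals of one axis form a
tree, so all shortest paths leave a portal into the same next portal. In place of this tree, the
signed crossings between two portals are treated as a closed cochain, which has a potential because
there are no holes (`hasPotentials_of_forall_not_isHole`). A shortest path never returns to a portal
it has left (`not_portal_of_descends`), so the potential is constant on its remainder; comparing two
paths at the root gives `portal_of_down` and `not_down_of_opposite_sides`.

For a child of x, the neighbors closer to the root are x and those common neighbors of x and the
child that are occupied but outside the cone of x. Hence the correct cone passes from parent to
child (`isGrowthCone_child`), and `TreeInvariant` survives every step under every scheduler. -/

lemma unitVec_ne_zero (i : ZMod 6) : unitVec i ≠ 0 := by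
  revert i; decide

lemma unitVec_injective : Function.Injective unitVec := by
  intro i j; revert i j; decide

lemma unitVec_add_three (i : ZMod 6) : unitVec (i + 3) = -unitVec i := by
  revert i; decide

lemma unitVec_add_two (i : ZMod 6) : unitVec (i + 2) = unitVec (i + 1) - unitVec i := by
  revert i; decide

lemma grid_adj_iff {x y : Node} : grid.Adj x y ↔ ∃ i, y = x + unitVec i := by
  constructor
  · rintro ⟨-, ⟨i, hi⟩ | ⟨i, hi⟩⟩
    · exact ⟨i, hi⟩
    · exact ⟨i + 3, by rw [unitVec_add_three, hi]; abel⟩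
  · rintro ⟨i, rfl⟩
    refine ⟨fun h => unitVec_ne_zero i ?_, Or.inl ⟨i, rfl⟩⟩
    simpa using h.symm

/-! ### Faces around empty nodes -/

/-- The unit triangle at `x` between the directions `i` and `i + 1`. -/
def cornerTriangle (x : Node) (i : ZMod 6) : Finset Node :=
  {x, x + unitVec i, x + unitVec (i + 1)}

lemma isUnitTriangle_cornerTriangle (x : Node) (i : ZMod 6) :
    IsUnitTriangle (cornerTriangle x i) := by
  refine SimpleGraph.is3Clique_triple_iff.2 ⟨grid_adj_iff.2 ⟨i, rfl⟩, grid_adj_iff.2 ⟨i + 1, rfl⟩,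
    grid_adj_iff.2 ⟨i + 2, ?_⟩⟩
  rw [unitVec_add_two]; abel

lemma mem_cornerTriangle_self (x : Node) (i : ZMod 6) : x ∈ cornerTriangle x i := by
  simp [cornerTriangle]

lemma mem_cornerTriangle_add (x : Node) (i : ZMod 6) :
    x + unitVec i ∈ cornerTriangle x i := by
  simp [cornerTriangle]

lemma eq_or_eq_add_unitVec_of_mem {T : Finset Node} (hT : IsUnitTriangle T) {x y : Node}
    (hx : x ∈ T) (hy : y ∈ T) : y = x ∨ ∃ i, y = x + unitVec i := by
  by_cases h : y = x
  · exact Or.inl h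
  · exact Or.inr (grid_adj_iff.1 (hT.isClique hx hy (Ne.symm h)))

lemma eq_add_one_or_of_unitVec_sub {i j k : ZMod 6} (h : unitVec j - unitVec i = unitVec k) :
    j = i + 1 ∨ i = j + 1 := by
  revert i j k; decide

lemma exists_eq_cornerTriangle {T : Finset Node} (hT : IsUnitTriangle T) {x : Node} (hx : x ∈ T) :
    ∃ i, T = cornerTriangle x i := by
  have hcard : (T.erase x).card = 2 := by rw [Finset.card_erase_of_mem hx, hT.card_eq]
  obtain ⟨y, z, -, hz⟩ := Finset.card_eq_two.1 hcard
  have hT' : T = {x, y, z} := by rw [← Finset.insert_erase hx, hz]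
  have h3 := hT
  rw [IsUnitTriangle, hT', SimpleGraph.is3Clique_triple_iff] at h3
  obtain ⟨h1, h2, h3⟩ := h3
  obtain ⟨i, rfl⟩ := grid_adj_iff.1 h1
  obtain ⟨j, rfl⟩ := grid_adj_iff.1 h2
  obtain ⟨k, hk⟩ := grid_adj_iff.1 h3
  have : unitVec j - unitVec i = unitVec k := by
    rw [add_assoc, add_left_cancel_iff] at hk
    rw [hk]; abel
  rcases eq_add_one_or_of_unitVec_sub this with rfl | rfl
  · exact ⟨i, hT'⟩
  · refine ⟨j, ?_⟩
    rw [hT', cornerTriangle]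
    congr 1
    exact Finset.pair_comm _ _

lemma sameFaceStep_cornerTriangle {P : Finset Node} {x : Node} (hx : x ∉ P) (i : ZMod 6) :
    SameFaceStep P (cornerTriangle x i) (cornerTriangle x (i + 1)) := by
  refine ⟨isUnitTriangle_cornerTriangle _ _, isUnitTriangle_cornerTriangle _ _, x,
    x + unitVec (i + 1), ?_, ?_, ?_, fun h => hx h.1⟩
  · simpa using unitVec_ne_zero (i + 1)
  · simp [cornerTriangle]
  · simp [cornerTriangle]

/-- All edges at an empty node are missing, so one can turn around it within a face. -/
lemma reflTransGen_cornerTriangle {P : Finset Node} {x : Node} (hx : x ∉ P) (i j : ZMod 6) :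
    Relation.ReflTransGen (SameFaceStep P) (cornerTriangle x i) (cornerTriangle x j) := by
  have key : ∀ n : ℕ, Relation.ReflTransGen (SameFaceStep P) (cornerTriangle x i)
      (cornerTriangle x (i + n)) := by
    intro n
    induction n with
    | zero => simpa using Relation.ReflTransGen.refl
    | succ n ih =>
      refine ih.tail ?_
      have := sameFaceStep_cornerTriangle hx (i + n)
      rwa [add_assoc, ← Nat.cast_succ] at this
  have := key (j - i).val
  rwa [ZMod.natCast_zmod_val, add_sub_cancel] at this

/-- In a configuration without holes, every finite set of empty nodes has an empty neighbor
outside. -/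
theorem exists_empty_neighbor {P : Finset Node} (hP : ∀ F, ¬ IsHole P F) {K : Finset Node}
    (hK : K.Nonempty) (hKP : ∀ x ∈ K, x ∉ P) :
    ∃ x ∈ K, ∃ i, x + unitVec i ∉ K ∧ x + unitVec i ∉ P := by
  by_contra! hcl
  obtain ⟨x₀, hx₀⟩ := hK
  set F : Set (Finset Node) :=
    {T' | Relation.ReflTransGen (SameFaceStep P) (cornerTriangle x₀ 0) T'} with hF
  -- A missing edge of a triangle that meets `K` has an empty end, which lies in `K` by `hcl`. So
  -- the face never leaves the triangles that touch `K`, and it is bounded.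
  have htri : ∀ T ∈ F, IsUnitTriangle T ∧ ∃ x ∈ K, x ∈ T := by
    intro T hT
    induction hT with
    | refl => exact ⟨isUnitTriangle_cornerTriangle _ _, x₀, hx₀, mem_cornerTriangle_self _ _⟩
    | @tail T₁ T₂ _ hs ih =>
      obtain ⟨hT, x, hxK, hxT⟩ := ih
      obtain ⟨-, hT', u, v, -, hu, hv, huv⟩ := hs
      refine ⟨hT', ?_⟩
      rw [Finset.mem_inter] at hu hv
      have aux : ∀ y ∈ T₁, y ∉ P → y ∈ K := by
        intro y hy hyP
        rcases eq_or_eq_add_unitVec_of_mem hT hxT hy with rfl | ⟨i, rfl⟩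
        · exact hxK
        · by_contra h
          exact hyP (hcl x hxK i h)
      by_cases h : u ∈ P
      · exact ⟨v, aux v hv.1 fun hvP => huv ⟨h, hvP⟩, hv.2⟩
      · exact ⟨u, aux u hu.1 h, hu.2⟩
  have hcorner : ∀ x ∈ K, (∃ T ∈ F, x ∈ T) → ∀ i, cornerTriangle x i ∈ F := by
    rintro x hx ⟨T, hT, hxT⟩ i
    obtain ⟨j, rfl⟩ := exists_eq_cornerTriangle (htri T hT).1 hxT
    exact Relation.ReflTransGen.trans hT (reflTransGen_cornerTriangle (hKP x hx) j i)
  classical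
  set K' := K.filter fun x => ∃ T ∈ F, x ∈ T with hK'
  have hK'ne : K'.Nonempty :=
    ⟨x₀, Finset.mem_filter.2 ⟨hx₀, _, Relation.ReflTransGen.refl, mem_cornerTriangle_self _ _⟩⟩
  have hout : ∀ x ∈ K', ∀ i, x + unitVec i ∉ K' → x + unitVec i ∈ faceVertices P F := by
    intro x hx i hi
    obtain ⟨hxK, hxF⟩ := Finset.mem_filter.1 hx
    have hT : ∃ T ∈ F, x + unitVec i ∈ T :=
      ⟨_, hcorner x hxK hxF i, mem_cornerTriangle_add _ _⟩
    exact ⟨hcl x hxK i fun h => hi (Finset.mem_filter.2 ⟨h, hT⟩), hT⟩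
  refine hP F ⟨⟨_, isUnitTriangle_cornerTriangle x₀ 0, rfl⟩, ?_, ?_⟩
  · refine (Finset.finite_toSet (K.biUnion fun x =>
      insert x (Finset.univ.image fun i => x + unitVec i)).powerset).subset ?_
    intro T hT
    obtain ⟨hT, x, hxK, hxT⟩ := htri T hT
    rw [Finset.mem_coe, Finset.mem_powerset]
    intro y hy
    rw [Finset.mem_biUnion]
    refine ⟨x, hxK, ?_⟩
    rcases eq_or_eq_add_unitVec_of_mem hT hxT hy with rfl | ⟨i, rfl⟩ <;> simp
  -- Two neighbors of a rightmost node and two of a leftmost node lie beyond `K'`, so they are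
  -- occupied. These four distinct vertices make the face a hole.
  · obtain ⟨x, hx, hmax⟩ := K'.exists_max_image (fun x => x.1) hK'ne
    obtain ⟨y, hy, hmin⟩ := K'.exists_min_image (fun x => x.1) hK'ne
    have h0 := hout x hx 0 fun h => absurd (hmax _ h) (by simp [unitVec])
    have h5 := hout x hx 5 fun h => absurd (hmax _ h) (by
      have : unitVec 5 = (1, -1) := rfl
      simp [this])
    have h3 := hout y hy 3 fun h => absurd (hmin _ h) (by
      have : unitVec 3 = (-1, 0) := rfl
      simp [this])
    have h2 := hout y hy 2 fun h => absurd (hmin _ h) (by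
      have : unitVec 2 = (-1, 1) := rfl
      simp [this])
    have hxy := hmax y hy
    have e0 : unitVec 0 = (1, 0) := rfl
    have e5 : unitVec 5 = (1, -1) := rfl
    have e3 : unitVec 3 = (-1, 0) := rfl
    have e2 : unitVec 2 = (-1, 1) := rfl
    set S : Finset Node := {x + unitVec 0, x + unitVec 5, y + unitVec 3, y + unitVec 2} with hS
    have hcard : S.card = 4 := by
      rw [hS, Finset.card_insert_of_notMem, Finset.card_insert_of_notMem,
        Finset.card_insert_of_notMem, Finset.card_singleton]
      · simp [e3, e2]
      · simp only [e5, e3, e2, Finset.mem_insert, Finset.mem_singleton, Prod.ext_iff, Prod.fst_add]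
        omega
      · simp only [e0, e5, e3, e2, Finset.mem_insert, Finset.mem_singleton, Prod.ext_iff,
          Prod.fst_add, Prod.snd_add]
        omega
    have hsub : (S : Set Node) ⊆ faceVertices P F := by
      intro z hz
      simp only [hS, Finset.coe_insert, Finset.coe_singleton, Set.mem_insert_iff,
        Set.mem_singleton_iff] at hz
      rcases hz with rfl | rfl | rfl | rfl <;> assumption
    have hfin : (faceVertices P F).Finite := P.finite_toSet.subset fun z hz => hz.1
    have := Set.ncard_le_ncard hsub hfin
    rw [Set.ncard_coe_finset, hcard] at this
    omega

/-! ### Potentials of closed cochains -/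

/-- Every closed antisymmetric integer-valued function on the edges of the grid between nodes of
`Q` is the difference of a potential: the clique complex of `Q` has trivial first cohomology. -/
def HasPotentials (Q : Finset Node) : Prop :=
  ∀ f : Node → Node → ℤ, (∀ x y, f y x = -f x y) →
    (∀ x i, x ∈ Q → x + unitVec i ∈ Q → x + unitVec (i + 1) ∈ Q →
      f x (x + unitVec i) + f (x + unitVec i) (x + unitVec (i + 1)) =
        f x (x + unitVec (i + 1))) →
    ∃ h : Node → ℤ, ∀ x i, x ∈ Q → x + unitVec i ∈ Q →
      h (x + unitVec i) - h x = f x (x + unitVec i)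

/-- Partial sums around the hexagon starting at `j`; only the edge that closes up at `j` is not
controlled. -/
lemma exists_cyclic_potential (a : ZMod 6 → ℤ) (j : ZMod 6) :
    ∃ g : ZMod 6 → ℤ, ∀ i, i + 1 ≠ j → g (i + 1) - g i = a i := by
  refine ⟨fun i => ∑ n ∈ Finset.range (i - j).val, a (j + n), fun i hi => ?_⟩
  have : (i + 1 - j).val = (i - j).val + 1 := by
    revert i j; decide
  simp only [this, Finset.sum_range_succ]
  simp

/-- Removing a node one of whose neighbors is absent preserves the existence of potentials. -/
lemma HasPotentials.of_insert {Q : Finset Node} {x : Node} (hx : x ∉ Q) {j : ZMod 6}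
    (hj : x + unitVec j ∉ Q) (h : HasPotentials (insert x Q)) : HasPotentials Q := by
  intro f hanti hclosed
  -- The cochain is extended to the edges at `x` by a potential along the hexagon around `x`, cut
  -- open at the absent node.
  obtain ⟨g, hg⟩ := exists_cyclic_potential
    (fun i => f (x + unitVec i) (x + unitVec (i + 1))) j
  -- The default value 0 gives `s x = 0`, which antisymmetry of `f'` at the pair `(x, x)` requires.
  set s : Node → ℤ := Function.extend (fun i => x + unitVec i) g 0 with hs
  have hinj : Function.Injective fun i => x + unitVec i :=
    fun _ _ h => unitVec_injective (add_left_cancel h)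
  have hsx : s x = 0 := by
    rw [hs, Function.extend_apply']
    · rfl
    · rintro ⟨i, hi⟩
      exact unitVec_ne_zero i (by simpa using hi)
  have hsi : ∀ i, s (x + unitVec i) = g i := fun i => hinj.extend_apply g 0 i
  have hsg : ∀ i, x + unitVec (i + 1) ∈ Q → s (x + unitVec (i + 1)) - s (x + unitVec i) =
      f (x + unitVec i) (x + unitVec (i + 1)) := by
    intro i hi
    rw [hsi, hsi]
    exact hg i fun h => hj (h ▸ hi)
  set f' : Node → Node → ℤ := fun u v => if u = x then s v else if v = x then -s u else f u v
    with hf'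
  have hf'l : ∀ v, f' x v = s v := fun v => by simp [hf']
  have hf'r : ∀ u, f' u x = -s u := fun u => by
    by_cases h : u = x
    · simp [hf', h, hsx]
    · simp [hf', h]
  have hf'o : ∀ u v, u ≠ x → v ≠ x → f' u v = f u v := fun u v hu hv => by simp [hf', hu, hv]
  have hanti' : ∀ u v, f' v u = -f' u v := by
    intro u v
    by_cases hu : u = x
    · subst hu; rw [hf'l, hf'r]
    · by_cases hv : v = x
      · subst hv; rw [hf'l, hf'r, neg_neg]
      · rw [hf'o _ _ hu hv, hf'o _ _ hv hu, hanti]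
  have hmem : ∀ {u}, u ∈ insert x Q → u ≠ x → u ∈ Q := fun h h' =>
    (Finset.mem_insert.1 h).resolve_left h'
  -- The new triangles have `x` as one of their three corners; in each case closedness is `hsg` on
  -- the opposite edge.
  obtain ⟨p, hp⟩ := h f' hanti' (by
    intro u i hu hv hw
    by_cases hux : u = x
    · subst hux
      have hv' := hmem hv (by simpa using unitVec_ne_zero i)
      have hw' := hmem hw (by simpa using unitVec_ne_zero (i + 1))
      rw [hf'l, hf'l, hf'o _ _ (by simpa using unitVec_ne_zero i)
        (by simpa using unitVec_ne_zero (i + 1)), ← hsg i hw']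
      abel
    by_cases hvx : u + unitVec i = x
    · have hu' : u = x + unitVec (i + 2 + 1) := by
        rw [add_assoc, show (2 + 1 : ZMod 6) = 3 by decide, unitVec_add_three, ← hvx]; abel
      have hw' : u + unitVec (i + 1) = x + unitVec (i + 2) := by
        rw [unitVec_add_two, ← hvx]; abel
      have hwx : u + unitVec (i + 1) ≠ x := by
        rw [hw']; simpa using unitVec_ne_zero (i + 2)
      have := hsg (i + 2) (hu' ▸ hmem hu hux)
      rw [← hu', ← hw'] at this
      rw [hvx, hf'l, hf'r, hf'o _ _ hux hwx, hanti (u + unitVec (i + 1)) u, ← this]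
      abel
    by_cases hwx : u + unitVec (i + 1) = x
    · have hu' : u = x + unitVec (i + 4) := by
        rw [show i + 4 = (i + 1) + 3 by ring, unitVec_add_three, ← hwx]; abel
      have hv' : u + unitVec i = x + unitVec (i + 4 + 1) := by
        rw [show i + 4 + 1 = (i + 2) + 3 by ring, unitVec_add_three, unitVec_add_two, ← hwx]; abel
      have := hsg (i + 4) (hv' ▸ hmem hv hvx)
      rw [← hu', ← hv'] at this
      rw [hwx, hf'r, hf'r, hf'o _ _ hux hvx, ← this]
      abel
    · rw [hf'o _ _ hux hvx, hf'o _ _ hvx hwx, hf'o _ _ hux hwx]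
      exact hclosed u i (hmem hu hux) (hmem hv hvx) (hmem hw hwx))
  refine ⟨p, fun u i hu hv => ?_⟩
  rw [hp u i (Finset.mem_insert_of_mem hu) (Finset.mem_insert_of_mem hv), hf'o]
  · rintro rfl; exact hx hu
  · intro h; exact hx (h ▸ hv)

/-- The potential sums `f` along the bottom row and then up a column. The two triangles of each unit
square carry the horizontal equation from one row to the next. -/
lemma hasPotentials_box (N : ℕ) :
    HasPotentials (Finset.Icc (-(N : ℤ)) N ×ˢ Finset.Icc (-(N : ℤ)) N) := by
  intro f hanti hclosed
  set pt : ℕ → ℕ → Node := fun m n => ((m : ℤ) - N, (n : ℤ) - N) with hpt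
  have e0 : unitVec 0 = (1, 0) := rfl
  have e1 : unitVec 1 = (0, 1) := rfl
  have e2 : unitVec 2 = (-1, 1) := rfl
  have ha : ∀ m n, pt m n + unitVec 0 = pt (m + 1) n := fun m n => by
    rw [e0]; ext <;> simp [hpt]; ring
  have hb : ∀ m n, pt m n + unitVec 1 = pt m (n + 1) := fun m n => by
    rw [e1]; ext <;> simp [hpt]; ring
  have hc : ∀ m n, pt (m + 1) n + unitVec 2 = pt m (n + 1) := fun m n => by
    rw [e2]; ext <;> simp [hpt] <;> ring
  have hmem : ∀ m n, pt m n ∈ Finset.Icc (-(N : ℤ)) N ×ˢ Finset.Icc (-(N : ℤ)) N ↔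
      m ≤ 2 * N ∧ n ≤ 2 * N := by
    intro m n
    simp only [hpt, Finset.mem_product, Finset.mem_Icc]
    omega
  have hex : ∀ x ∈ Finset.Icc (-(N : ℤ)) N ×ˢ Finset.Icc (-(N : ℤ)) N, ∃ m n, x = pt m n := by
    rintro ⟨a, b⟩ h
    simp only [Finset.mem_product, Finset.mem_Icc] at h
    refine ⟨(a + N).toNat, (b + N).toNat, ?_⟩
    simp only [hpt, Prod.mk.injEq]
    omega
  set H : ℕ → ℕ → ℤ := fun m n => ∑ i ∈ Finset.range m, f (pt i 0) (pt (i + 1) 0) +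
    ∑ j ∈ Finset.range n, f (pt m j) (pt m (j + 1)) with hH
  have hH1 : ∀ m n, H m (n + 1) - H m n = f (pt m n) (pt m (n + 1)) := fun m n => by
    simp only [hH, Finset.sum_range_succ]; ring
  have hlow : ∀ m n, m + 1 ≤ 2 * N → n + 1 ≤ 2 * N →
      f (pt m n) (pt (m + 1) n) + f (pt (m + 1) n) (pt m (n + 1)) = f (pt m n) (pt m (n + 1)) := by
    intro m n hm hn
    have := hclosed (pt m n) 0
    rw [zero_add, ha, hb, hmem, hmem, hmem] at this
    exact this (by omega) (by omega) (by omega)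
  have hhigh : ∀ m n, m + 1 ≤ 2 * N → n + 1 ≤ 2 * N →
      f (pt (m + 1) n) (pt (m + 1) (n + 1)) + f (pt (m + 1) (n + 1)) (pt m (n + 1)) =
        f (pt (m + 1) n) (pt m (n + 1)) := by
    intro m n hm hn
    have := hclosed (pt (m + 1) n) 1
    rw [show (1 + 1 : ZMod 6) = 2 by decide, hb, hc, hmem, hmem, hmem] at this
    exact this (by omega) (by omega) (by omega)
  have hH0 : ∀ m n, m + 1 ≤ 2 * N → n ≤ 2 * N →
      H (m + 1) n - H m n = f (pt m n) (pt (m + 1) n) := by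
    intro m n hm hn
    induction n with
    | zero => simp only [hH, Finset.sum_range_succ]; simp
    | succ n ih =>
      have h1 := ih (by omega)
      have h2 := hlow m n hm hn
      have h3 := hhigh m n hm hn
      have h4 := hH1 m n
      have h5 := hH1 (m + 1) n
      have h6 := hanti (pt m (n + 1)) (pt (m + 1) (n + 1))
      linarith
  have hH2 : ∀ m n, m + 1 ≤ 2 * N → n + 1 ≤ 2 * N →
      H m (n + 1) - H (m + 1) n = f (pt (m + 1) n) (pt m (n + 1)) := by
    intro m n hm hn
    linarith [hH0 m n hm (by omega), hlow m n hm hn, hH1 m n]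
  set h : Node → ℤ := fun x => H (x.1 + N).toNat (x.2 + N).toNat with hh
  have hhpt : ∀ m n, h (pt m n) = H m n := fun m n => by simp [hh, hpt]
  have half : ∀ x i, (i = 0 ∨ i = 1 ∨ i = 2) →
      x ∈ Finset.Icc (-(N : ℤ)) N ×ˢ Finset.Icc (-(N : ℤ)) N →
      x + unitVec i ∈ Finset.Icc (-(N : ℤ)) N ×ˢ Finset.Icc (-(N : ℤ)) N →
      h (x + unitVec i) - h x = f x (x + unitVec i) := by
    intro x i hi hx hy
    obtain ⟨m, n, rfl⟩ := hex x hx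
    rcases hi with rfl | rfl | rfl
    · rw [ha] at hy ⊢
      rw [hhpt, hhpt]
      exact hH0 m n ((hmem _ _).1 hy).1 ((hmem _ _).1 hy).2
    · rw [hb, hhpt, hhpt]
      exact hH1 m n
    · obtain _ | m := m
      · rw [e2] at hy
        simp [hpt] at hy
      · rw [hc] at hy ⊢
        rw [hhpt, hhpt]
        exact hH2 m n ((hmem _ _).1 hx).1 ((hmem _ _).1 hy).2
  refine ⟨h, fun x i hx hy => ?_⟩
  by_cases hi : i = 0 ∨ i = 1 ∨ i = 2
  · exact half x i hi hx hy
  · have hi' : i + 3 = 0 ∨ i + 3 = 1 ∨ i + 3 = 2 := by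
      clear hx hy; revert i; decide
    have hback : x + unitVec i + unitVec (i + 3) = x := by rw [unitVec_add_three]; abel
    have := half (x + unitVec i) (i + 3) hi' hy (by rwa [hback])
    rw [hback] at this
    rw [hanti (x + unitVec i) x, ← this]
    abel

/-- The empty nodes are dug out of a large box one at a time. By `exists_empty_neighbor`, applied to
the empty nodes still present, one of them always has an absent neighbor, as
`HasPotentials.of_insert` needs. -/
theorem hasPotentials_of_forall_not_isHole {P : Finset Node} (hP : ∀ F, ¬ IsHole P F) :
    HasPotentials P := by
  have key : ∀ n (Q : Finset Node), (Q \ P).card = n → P ⊆ Q → HasPotentials Q →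
      HasPotentials P := by
    intro n
    induction n with
    | zero =>
      intro Q hc hPQ hQ
      rw [Finset.card_eq_zero, Finset.sdiff_eq_empty_iff_subset] at hc
      rwa [hPQ.antisymm hc]
    | succ n ih =>
      intro Q hc hPQ hQ
      obtain ⟨x, hx, i, hi, hiP⟩ := exists_empty_neighbor hP (K := Q \ P)
        (Finset.card_pos.1 (by omega)) fun x hx => (Finset.mem_sdiff.1 hx).2
      obtain ⟨hxQ, hxP⟩ := Finset.mem_sdiff.1 hx
      refine ih (Q.erase x) ?_ ?_ ?_
      · rw [Finset.erase_sdiff_comm, Finset.card_erase_of_mem hx, hc]; rfl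
      · exact fun y hy => Finset.mem_erase.2 ⟨fun h => hxP (h ▸ hy), hPQ hy⟩
      · refine HasPotentials.of_insert (x := x) (j := i) (Finset.notMem_erase _ _) ?_ ?_
        · intro h
          exact hi (Finset.mem_sdiff.2 ⟨Finset.mem_of_mem_erase h, hiP⟩)
        · rwa [Finset.insert_erase hxQ]
  obtain ⟨N, hN⟩ : ∃ N : ℕ, ∀ x ∈ P, x.1.natAbs ≤ N ∧ x.2.natAbs ≤ N := by
    refine ⟨P.sup fun x => max x.1.natAbs x.2.natAbs, fun x hx => ?_⟩
    have := Finset.le_sup (f := fun x : Node => max x.1.natAbs x.2.natAbs) hx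
    exact ⟨(le_max_left _ _).trans this, (le_max_right _ _).trans this⟩
  refine key _ _ rfl ?_ (hasPotentials_box N)
  intro x hx
  have := hN x hx
  simp only [Finset.mem_product, Finset.mem_Icc]
  omega

/-! ### Linear functionals -/

/-- The scalar product of lattice coordinates. -/
def pairing (c x : Node) : ℤ := c.1 * x.1 + c.2 * x.2

lemma pairing_add (c x y : Node) : pairing c (x + y) = pairing c x + pairing c y := by
  simp only [pairing, Prod.fst_add, Prod.snd_add]; ring

lemma pairing_nsmul (c x : Node) (n : ℕ) : pairing c (n • x) = n * pairing c x := by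
  rw [pairing, Prod.smul_fst, Prod.smul_snd, nsmul_eq_mul, nsmul_eq_mul, pairing]; ring

/-- A functional that vanishes on `unitVec a`; its sign tells the two sides of the lines in
direction `a` apart. -/
def normal (a : ZMod 6) : Node := ((unitVec a).2, -(unitVec a).1)

/-- The side of a line in direction `a` to which the direction `i` points. -/
def side (a i : ZMod 6) : ℤ := pairing (normal a) (unitVec i)

lemma side_self (a : ZMod 6) : side a a = 0 := by
  revert a; decide

/-- Around the hexagon each `normal k` takes the values 0, -1, -1, 0, 1, 1. Two of the six equal 1
at `a`; the one vanishing on the direction next to `a` on the side of `i` works. It serves to show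
that a detour starting with `i` is longer than the straight segment. -/
lemma exists_functional {a i : ZMod 6} (h : side a i ≠ 0) :
    ∃ c : Node, (∀ k, pairing c (unitVec k) ≤ 1) ∧ pairing c (unitVec a) = 1 ∧
      pairing c (unitVec i) ≤ 0 := by
  have : ∃ k : ZMod 6, ∀ c, c = normal k → (∀ k, pairing c (unitVec k) ≤ 1) ∧
      pairing c (unitVec a) = 1 ∧ pairing c (unitVec i) ≤ 0 := by
    revert a i; unfold side; simp only [forall_eq]; decide
  obtain ⟨k, hk⟩ := this
  exact ⟨_, hk _ rfl⟩

/-! ### Portals -/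

/-- Two nodes lie in the same portal of `P` with axis `a`: they are joined by steps in the
directions `a` and `-a` between nodes of `P`. -/
def Portal (P : Finset Node) (a : ZMod 6) : Node → Node → Prop :=
  Relation.ReflTransGen fun x y => x ∈ P ∧ y ∈ P ∧ (y = x + unitVec a ∨ x = y + unitVec a)

namespace Portal

variable {P : Finset Node} {a : ZMod 6} {x y z : Node}

lemma symm (h : Portal P a x y) : Portal P a y x :=
  have : Std.Symm fun x y => x ∈ P ∧ y ∈ P ∧ (y = x + unitVec a ∨ x = y + unitVec a) :=
    ⟨fun _ _ h => ⟨h.2.1, h.1, h.2.2.symm⟩⟩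
  Relation.ReflTransGen.stdSymm.symm _ _ h

lemma trans (h : Portal P a x y) (h' : Portal P a y z) : Portal P a x z :=
  Relation.ReflTransGen.trans h h'

lemma step {i : ZMod 6} (hi : side a i = 0) (hx : x ∈ P) (hy : x + unitVec i ∈ P) :
    Portal P a x (x + unitVec i) := by
  refine Relation.ReflTransGen.single ⟨hx, hy, ?_⟩
  have : i = a ∨ i = a + 3 := by
    clear hx hy; revert a i; decide
  rcases this with rfl | rfl
  · exact Or.inl rfl
  · right; rw [unitVec_add_three]; abel

lemma congr_left (h : Portal P a x y) : Portal P a z x ↔ Portal P a z y :=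
  ⟨fun h' => h'.trans h, fun h' => h'.trans h.symm⟩

lemma pairing_eq (h : Portal P a x y) : pairing (normal a) x = pairing (normal a) y := by
  induction h with
  | refl => rfl
  | tail _ h ih =>
    have h0 : pairing (normal a) (unitVec a) = 0 := side_self a
    rcases h.2.2 with h | h
    · rw [ih, h, pairing_add, h0, add_zero]
    · rw [ih, h, pairing_add, h0, add_zero]

lemma exists_zsmul (h : Portal P a x y) (hx : x ∈ P) :
    ∃ n : ℤ, y = x + n • unitVec a ∧
      ∀ m : ℤ, 0 ≤ m ∧ m ≤ n ∨ n ≤ m ∧ m ≤ 0 → x + m • unitVec a ∈ P := by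
  induction h with
  | refl =>
    refine ⟨0, by simp, fun m hm => ?_⟩
    obtain rfl : m = 0 := by omega
    simpa using hx
  | @tail y z _ h ih =>
    obtain ⟨n, rfl, hn⟩ := ih
    obtain ⟨-, hz, h⟩ := h
    rcases h with h | h
    · have hz' : z = x + (n + 1) • unitVec a := by rw [h, add_smul, one_smul, add_assoc]
      refine ⟨n + 1, hz', fun m hm => ?_⟩
      by_cases hmn : m = n + 1
      · rwa [hmn, ← hz']
      · exact hn m (by omega)
    · have hz' : z = x + (n - 1) • unitVec a := by
        rw [sub_smul, one_smul, ← add_sub_assoc, h, add_sub_cancel_right]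
      refine ⟨n - 1, hz', fun m hm => ?_⟩
      by_cases hmn : m = n - 1
      · rwa [hmn, ← hz']
      · exact hn m (by omega)

/-- A portal is a segment. -/
lemma exists_nsmul (h : Portal P a x y) (hx : x ∈ P) :
    ∃ b, (b = a ∨ b = a + 3) ∧ ∃ n : ℕ, y = x + n • unitVec b ∧
      ∀ m : ℕ, m ≤ n → x + m • unitVec b ∈ P := by
  obtain ⟨n, hy, hn⟩ := h.exists_zsmul hx
  rcases le_total 0 n with h0 | h0
  · lift n to ℕ using h0
    refine ⟨a, Or.inl rfl, n, by simpa using hy, fun m hm => ?_⟩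
    have := hn m (by omega)
    simpa using this
  · obtain ⟨k, rfl⟩ : ∃ k : ℕ, n = -(k : ℤ) := ⟨n.natAbs, by omega⟩
    refine ⟨a + 3, Or.inr rfl, k, ?_, fun m hm => ?_⟩
    · rw [hy, unitVec_add_three]; simp
    · have := hn (-(m : ℤ)) (by omega)
      rw [unitVec_add_three]
      simpa using this

lemma mem_between (h : Portal P a x (x + 2 • unitVec a)) (hx : x ∈ P) : x + unitVec a ∈ P := by
  obtain ⟨n, hn, hP⟩ := h.exists_zsmul hx
  have h2 : n = 2 := by
    have h0 : n • unitVec a = (2 : ℤ) • unitVec a := by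
      rw [add_left_cancel hn.symm, ← natCast_zsmul]; rfl
    exact smul_left_injective ℤ (unitVec_ne_zero a) h0
  have := hP 1 (by omega)
  simpa using this

end Portal

open scoped Classical in
/-- The signed crossings from the portal of `x` into the portal of `y`. -/
noncomputable def crossing (P : Finset Node) (a : ZMod 6) (x y u v : Node) : ℤ :=
  (if Portal P a x u ∧ Portal P a y v then 1 else 0) -
    if Portal P a x v ∧ Portal P a y u then 1 else 0

section Crossing

variable {P : Finset Node} {a : ZMod 6} {x y u v w : Node}

lemma crossing_antisymm : crossing P a x y v u = -crossing P a x y u v := by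
  simp only [crossing]; ring

lemma crossing_congr_left (h : Portal P a u v) :
    crossing P a x y u w = crossing P a x y v w := by
  unfold crossing
  congr 2 <;> simp only [h.congr_left]

lemma crossing_congr_right (h : Portal P a u v) :
    crossing P a x y w u = crossing P a x y w v := by
  rw [crossing_antisymm, crossing_congr_left h, crossing_antisymm, neg_neg]

lemma crossing_self : crossing P a x y u u = 0 := by
  simp [crossing]

lemma crossing_eq_zero_of_portal (h : Portal P a u v) : crossing P a x y u v = 0 := by
  rw [crossing_congr_left h, crossing_self]

lemma crossing_eq_zero_left (hu : ¬ Portal P a x u) (hv : ¬ Portal P a x v) :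
    crossing P a x y u v = 0 := by
  simp [crossing, hu, hv]

lemma crossing_eq_zero_right (hu : ¬ Portal P a y u) (hv : ¬ Portal P a y v) :
    crossing P a x y u v = 0 := by
  simp [crossing, hu, hv]

/-- Every unit triangle has an edge parallel to the axis. Its ends share a portal, so crossings
vanish on it and cancel on the other two edges. -/
lemma HasPotentials.crossing (hP : HasPotentials P) (a : ZMod 6) (x y : Node) :
    ∃ h : Node → ℤ, ∀ u i, u ∈ P → u + unitVec i ∈ P →
      h (u + unitVec i) - h u = crossing P a x y u (u + unitVec i) := by
  refine hP _ (fun _ _ => crossing_antisymm) fun u i hu hv hw => ?_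
  have : side a i = 0 ∨ side a (i + 1) = 0 ∨ side a (i + 2) = 0 := by
    clear hu hv hw; revert a i; decide
  rcases this with h | h | h
  · rw [crossing_eq_zero_of_portal (Portal.step h hu hv), zero_add,
      crossing_congr_left (Portal.step h hu hv)]
  · have h' := Portal.step h hu hw
    rw [crossing_eq_zero_of_portal h', ← crossing_congr_right h', crossing_antisymm]
    ring
  · have e : u + unitVec (i + 1) = u + unitVec i + unitVec (i + 2) := by
      rw [unitVec_add_two]; abel
    have h' : Portal P a (u + unitVec i) (u + unitVec (i + 1)) := by
      rw [e]; exact Portal.step h hv (e ▸ hw)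
    rw [crossing_eq_zero_of_portal h', crossing_congr_right h', add_zero]

end Crossing

/-! ### Distances -/

/-- `d` is the distance from `r` in the subgraph of the grid induced by `P`. -/
structure IsDistFrom (P : Finset Node) (r : Node) (d : Node → ℕ) : Prop where
  root_mem : r ∈ P
  root : d r = 0
  eq_root : ∀ x ∈ P, d x = 0 → x = r
  le_add_one : ∀ x i, x ∈ P → x + unitVec i ∈ P → d (x + unitVec i) ≤ d x + 1
  exists_down : ∀ x ∈ P, d x ≠ 0 → ∃ i, x + unitVec i ∈ P ∧ d (x + unitVec i) + 1 = d x

/-- The neighbor of `x` in direction `i` is occupied and closer to the root. -/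
def Down (P : Finset Node) (d : Node → ℕ) (x : Node) (i : ZMod 6) : Prop :=
  x + unitVec i ∈ P ∧ d (x + unitVec i) + 1 = d x

/-- The neighbor of `x` in direction `i` is occupied and further away from the root. -/
def Up (P : Finset Node) (d : Node → ℕ) (x : Node) (i : ZMod 6) : Prop :=
  x + unitVec i ∈ P ∧ d (x + unitVec i) = d x + 1

/-- `y` can be reached from `x` along edges towards the root. -/
def Descends (P : Finset Node) (d : Node → ℕ) : Node → Node → Prop :=
  Relation.ReflTransGen fun x y => x ∈ P ∧ ∃ i, Down P d x i ∧ y = x + unitVec i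

namespace IsDistFrom

variable {P : Finset Node} {r : Node} {d : Node → ℕ} (hd : IsDistFrom P r d)
include hd

lemma le_add_one' {x : Node} {i : ZMod 6} (hx : x ∈ P) (hy : x + unitVec i ∈ P) :
    d x ≤ d (x + unitVec i) + 1 := by
  have e : x + unitVec i + unitVec (i + 3) = x := by rw [unitVec_add_three]; abel
  have := hd.le_add_one (x + unitVec i) (i + 3) hy (by rwa [e])
  rwa [e] at this

lemma descends_root {x : Node} (hx : x ∈ P) : Descends P d x r := by
  generalize hn : d x = n
  induction n generalizing x with
  | zero => rw [hd.eq_root x hx hn]; exact Relation.ReflTransGen.refl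
  | succ n ih =>
    obtain ⟨i, hi, hi'⟩ := hd.exists_down x hx (by omega)
    exact Relation.ReflTransGen.head ⟨hx, i, ⟨hi, hi'⟩, rfl⟩ (ih hi (by omega))

lemma le_add_of_segment {x : Node} {b : ZMod 6} {n : ℕ}
    (h : ∀ m : ℕ, m ≤ n → x + m • unitVec b ∈ P) : d x ≤ d (x + n • unitVec b) + n := by
  induction n with
  | zero => simp
  | succ n ih =>
    have h1 := ih fun m hm => h m (by omega)
    have h2 := h (n + 1) le_rfl
    rw [succ_nsmul, ← add_assoc x] at h2 ⊢
    have := hd.le_add_one' (h n (by omega)) h2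
    omega

omit hd in
-- Each descending step lowers `d` by exactly 1 and raises the functional by at most 1.
lemma pairing_sub_le_of_descends {c x y : Node} (hc : ∀ k, pairing c (unitVec k) ≤ 1)
    (h : Descends P d x y) : pairing c y - pairing c x ≤ d x - d y := by
  induction h with
  | refl => simp
  | tail _ h ih =>
    obtain ⟨-, i, ⟨-, hi⟩, rfl⟩ := h
    rw [pairing_add]
    have := hc i
    omega

/-- A shortest path to the root that leaves a portal does not return to it. -/
lemma not_portal_of_descends {a i : ZMod 6} {p y : Node} (hp : p ∈ P) (hi : Down P d p i)
    (hai : side a i ≠ 0) (h : Descends P d (p + unitVec i) y) : ¬ Portal P a p y := by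
  intro hpy
  obtain ⟨b, hb, n, rfl, hn⟩ := hpy.exists_nsmul hp
  have hbi : side b i ≠ 0 := by
    have : ∀ a i, side a i ≠ 0 → side (a + 3) i ≠ 0 := by decide
    rcases hb with rfl | rfl
    · exact hai
    · exact this _ _ hai
  -- The functional gains `n` along the segment and nothing on the step `i`, so the path through `p
  -- + unitVec i` needs at least `n + 1` steps, while the portal itself needs only `n`.
  obtain ⟨c, hc, hcb, hci⟩ := exists_functional hbi
  have h1 := pairing_sub_le_of_descends hc h
  have h2 := hd.le_add_of_segment hn
  rw [pairing_add, pairing_add, pairing_nsmul, hcb] at h1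
  have := hi.2
  omega

omit hd in
lemma potential_eq_of_descends {h : Node → ℤ} {x y : Node} (hxy : Descends P d x y)
    (H : ∀ u i, Descends P d x u → Descends P d x (u + unitVec i) → u ∈ P →
      u + unitVec i ∈ P → h (u + unitVec i) - h u = 0) : h y = h x := by
  induction hxy with
  | refl => rfl
  | tail hu hs ih =>
    obtain ⟨hup, i, hi, rfl⟩ := hs
    have := H _ i hu (hu.tail ⟨hup, i, hi, rfl⟩) hup hi.1
    omega

/-- Two shortest paths to the root that leave the same portal continue in the same portal. -/
theorem portal_of_down (hP : HasPotentials P) {a i j : ZMod 6} {p q : Node} (hp : p ∈ P)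
    (hq : q ∈ P) (hpq : Portal P a p q) (hi : Down P d p i) (hj : Down P d q j)
    (hai : side a i ≠ 0) (haj : side a j ≠ 0) :
    Portal P a (p + unitVec i) (q + unitVec j) := by
  by_contra hne
  -- The path from `p` makes one counted crossing, its first step; the path from `q` makes none, and
  -- neither do moves inside the portal. So `h r` would have two values.
  obtain ⟨h, hh⟩ := hP.crossing a p (p + unitVec i)
  have hpi : ¬ Portal P a p (p + unitVec i) :=
    hd.not_portal_of_descends hp hi hai Relation.ReflTransGen.refl
  have hqj : ¬ Portal P a p (q + unitVec j) := fun h' =>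
    hd.not_portal_of_descends hq hj haj Relation.ReflTransGen.refl (hpq.symm.trans h')
  have h1 : h r = h (p + unitVec i) := by
    refine potential_eq_of_descends (hd.descends_root hi.1) fun u k hu hu' hup hup' => ?_
    rw [hh u k hup hup', crossing_eq_zero_left] <;>
      exact hd.not_portal_of_descends hp hi hai ‹_›
  have h2 : h r = h (q + unitVec j) := by
    refine potential_eq_of_descends (hd.descends_root hj.1) fun u k hu hu' hup hup' => ?_
    rw [hh u k hup hup', crossing_eq_zero_left] <;>
      exact fun h' => hd.not_portal_of_descends hq hj haj ‹_› (hpq.symm.trans h')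
  have h3 : h (p + unitVec i) - h p = 1 := by
    rw [hh p i hp hi.1, crossing, if_pos ⟨Relation.ReflTransGen.refl, Relation.ReflTransGen.refl⟩,
      if_neg fun h' => hpi h'.1, sub_zero]
  have h4 : h (q + unitVec j) - h q = 0 := by
    rw [hh q j hq hj.1, crossing, if_neg fun h' => hne h'.2, if_neg fun h' => hqj h'.1, sub_zero]
  have h5 : h q = h p := by
    clear hj hqj hq h4 h2 hne
    induction hpq with
    | refl => rfl
    | @tail u v huv hs ih =>
      obtain ⟨hu, hv, rfl | rfl⟩ := hs
      · have := hh u a hu hv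
        rw [crossing_eq_zero_of_portal (Portal.step (side_self a) hu hv)] at this
        omega
      · have := hh v a hv hu
        rw [crossing_eq_zero_of_portal (Portal.step (side_self a) hv hu)] at this
        omega
  omega

/-- Shortest paths to the root do not leave two adjacent portals on opposite sides. -/
theorem not_down_of_opposite_sides (hP : HasPotentials P) {a i j k : ZMod 6} {p : Node}
    (hp : p ∈ P) (hq : p + unitVec k ∈ P) (hi : Down P d p i) (hj : Down P d (p + unitVec k) j)
    (hak : side a k ≠ 0) (hai : side a i = -side a k) (haj : side a j = side a k) : False := by
  have hline : ∀ {u v}, Portal P a u v → pairing (normal a) u = pairing (normal a) v :=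
    fun h => h.pairing_eq
  have hu : ∀ u l, pairing (normal a) (u + unitVec l) = pairing (normal a) u + side a l :=
    fun u l => pairing_add _ _ _
  have hai' : side a i ≠ 0 := by omega
  have haj' : side a j ≠ 0 := by omega
  -- Neither path crosses between the two portals: each starts outwards and avoids the portal it
  -- came from. The edge from `p` to `p + unitVec k`, however, counts 1.
  obtain ⟨h, hh⟩ := hP.crossing a p (p + unitVec k)
  have h1 : h r = h (p + unitVec i) := by
    refine potential_eq_of_descends (hd.descends_root hi.1) fun u k hu hu' hup hup' => ?_
    rw [hh u k hup hup', crossing_eq_zero_left] <;>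
      exact hd.not_portal_of_descends hp hi hai' ‹_›
  have h2 : h r = h (p + unitVec k + unitVec j) := by
    refine potential_eq_of_descends (hd.descends_root hj.1) fun u k hu hu' hup hup' => ?_
    rw [hh u k hup hup', crossing_eq_zero_right] <;>
      exact hd.not_portal_of_descends hq hj haj' ‹_›
  have h3 : h (p + unitVec k) - h p = 1 := by
    rw [hh p k hp hq, crossing, if_pos ⟨Relation.ReflTransGen.refl, Relation.ReflTransGen.refl⟩,
      if_neg, sub_zero]
    intro h'
    have := hline h'.1
    rw [hu] at this
    omega
  have h4 : h (p + unitVec i) - h p = 0 := by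
    rw [hh p i hp hi.1, crossing, if_neg, if_neg, sub_zero]
    · intro h'
      have := hline h'.1
      rw [hu] at this
      omega
    · intro h'
      have := hline h'.2
      rw [hu, hu] at this
      omega
  have h5 : h (p + unitVec k + unitVec j) - h (p + unitVec k) = 0 := by
    rw [hh _ j hq hj.1, crossing, if_neg, if_neg, sub_zero]
    · intro h'
      have := hline h'.1
      rw [hu, hu] at this
      omega
    · intro h'
      have := hline h'.1
      rw [hu] at this
      omega
  omega

/-- The directions towards the root are pairwise adjacent. -/
theorem down_adjacent (hP : HasPotentials P) {p : Node} (hp : p ∈ P) {i j : ZMod 6}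
    (hi : Down P d p i) (hj : Down P d p j) : j = i ∨ j = i + 1 ∨ j = i - 1 := by
  by_contra hne
  -- Distinct non-adjacent directions lie strictly on opposite sides of some axis, hence cannot lead
  -- into the same portal.
  have : ∃ a, side a i ≠ 0 ∧ side a j ≠ 0 ∧ side a i ≠ side a j := by
    clear hi hj; revert i j; decide
  obtain ⟨a, hai, haj, haij⟩ := this
  have := (hd.portal_of_down hP hp hp Relation.ReflTransGen.refl hi hj hai haj).pairing_eq
  rw [pairing_add, pairing_add] at this
  exact haij (add_left_cancel this)

/-- Two adjacent nodes at the same distance from the root have a common neighbor closer to it. -/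
theorem down_of_eq (hP : HasPotentials P) {p : Node} (hp : p ∈ P) {k : ZMod 6}
    (hk : p + unitVec k ∈ P) (h : d (p + unitVec k) = d p) :
    Down P d p (k + 1) ∨ Down P d p (k - 1) := by
  have h0 : d p ≠ 0 := by
    intro h0
    have h1 := hd.eq_root p hp h0
    have h2 := hd.eq_root _ hk (h.trans h0)
    rw [h1] at h2
    exact unitVec_ne_zero k (by simpa using h2)
  obtain ⟨i, hi⟩ := hd.exists_down p hp h0
  obtain ⟨j, hj⟩ := hd.exists_down _ hk (by omega)
  change Down P d p i at hi
  change Down P d (p + unitVec k) j at hj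
  by_contra! hne
  have hi1 : i ≠ k + 1 := fun e => hne.1 (e ▸ hi)
  have hi2 : i ≠ k - 1 := fun e => hne.2 (e ▸ hi)
  have hi3 : i ≠ k := by rintro rfl; have := hi.2; omega
  have hj1 : j ≠ k + 2 := by
    rintro rfl
    have e : p + unitVec k + unitVec (k + 2) = p + unitVec (k + 1) := by
      rw [unitVec_add_two]; abel
    rw [Down, e, h] at hj
    exact hne.1 hj
  have hj2 : j ≠ k - 2 := by
    rintro rfl
    have e : p + unitVec k + unitVec (k - 2) = p + unitVec (k - 1) := by
      have : unitVec k + unitVec (k - 2) = unitVec (k - 1) := by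
        clear * -; revert k; decide
      rw [add_assoc, this]
    rw [Down, e, h] at hj
    exact hne.2 hj
  have hj3 : j ≠ k + 3 := by
    rintro rfl
    have e : p + unitVec k + unitVec (k + 3) = p := by rw [unitVec_add_three]; abel
    have := hj.2
    rw [e] at this
    omega
  -- What remains is `i` in `k + 2, k + 3, k + 4` and `j` in `k - 1, k, k + 1`. Either the paths
  -- diverge across some axis, or both leave the line in direction `k` on the same side, with `i = k
  -- ± 2` and `j = k ± 1`.
  have hcases : (∃ a, side a k ≠ 0 ∧ side a i = -side a k ∧ side a j = side a k) ∨
      side k i ≠ 0 ∧ side k j ≠ 0 ∧ unitVec k + unitVec j = unitVec i + 2 • unitVec k ∧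
        ((unitVec i + unitVec k = unitVec (k + 1)) ∨ unitVec i + unitVec k = unitVec (k - 1)) := by
    clear * - hi1 hi2 hi3 hj1 hj2 hj3
    revert i j k; decide
  rcases hcases with ⟨a, hak, hai, haj⟩ | ⟨hai, haj, hij, hc⟩
  · exact hd.not_down_of_opposite_sides hP hp hk hi hj hak hai haj
  · have hport := hd.portal_of_down hP hp hk (Portal.step (side_self k) hp hk) hi hj hai haj
    rw [add_assoc p, hij, ← add_assoc] at hport
    -- The node between the two second nodes of the paths is a common neighbor of `p` and `p +
    -- unitVec k`; it is occupied because portals are segments.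
    have hmem := hport.mem_between hi.1
    have hle := hd.le_add_one _ _ hi.1 hmem
    have hge : d p ≤ d (p + unitVec i + unitVec k) + 1 := by
      rw [add_assoc] at hmem ⊢
      rcases hc with hc | hc <;> rw [hc] at hmem ⊢ <;> exact hd.le_add_one' hp hmem
    have hi' := hi.2
    by_cases hlow : d (p + unitVec i + unitVec k) + 1 = d p
    · rw [add_assoc] at hmem hlow
      rcases hc with hc | hc <;> rw [hc] at hmem hlow
      · exact hne.1 ⟨hmem, hlow⟩
      · exact hne.2 ⟨hmem, hlow⟩
    -- If it were not closer, it would be at distance `d p` and have closer neighbors in the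
    -- opposite directions `k` and `k + 3`.
    · have e1 : p + unitVec i + unitVec k + unitVec k = p + unitVec k + unitVec j := by
        rw [add_assoc p (unitVec k), hij, two_nsmul]; abel
      have e2 : p + unitVec i + unitVec k + unitVec (k + 3) = p + unitVec i := by
        rw [unitVec_add_three]; abel
      have hj' := hj.2
      have := hd.down_adjacent hP hmem (i := k) (j := k + 3)
        (by rw [Down, e1]; exact ⟨hj.1, by omega⟩) (by rw [Down, e2]; exact ⟨hi.1, by omega⟩)
      clear * - this
      revert k; decide

/-- The occupied neighbors that are further away from the root are those that are neither closer
to it nor next to a neighbor that is closer. -/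
theorem up_iff (hP : HasPotentials P) {p : Node} (hp : p ∈ P) {j : ZMod 6}
    (hj : p + unitVec j ∈ P) :
    Up P d p j ↔ ¬ Down P d p j ∧ ¬ Down P d p (j + 1) ∧ ¬ Down P d p (j - 1) := by
  constructor
  · intro h
    have hup := h.2
    refine ⟨fun h' => by have := h'.2; omega, fun h' => ?_, fun h' => ?_⟩
    · have e : p + unitVec (j + 1) = p + unitVec j + unitVec (j + 2) := by
        rw [unitVec_add_two]; abel
      have := h'.2
      have hm := h'.1
      rw [e] at this hm
      have := hd.le_add_one' hj hm
      omega
    · have e : p + unitVec (j - 1) = p + unitVec j + unitVec (j - 2) := by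
        have : unitVec j + unitVec (j - 2) = unitVec (j - 1) := by
          clear * -; revert j; decide
        rw [add_assoc, this]
      have := h'.2
      have hm := h'.1
      rw [e] at this hm
      have := hd.le_add_one' hj hm
      omega
  · rintro ⟨h1, h2, h3⟩
    refine ⟨hj, ?_⟩
    have hle := hd.le_add_one p j hp hj
    have hge := hd.le_add_one' hp hj
    by_contra hne
    by_cases he : d (p + unitVec j) = d p
    · rcases hd.down_of_eq hP hp hj he with h | h
      · exact h2 h
      · exact h3 h
    · exact h1 ⟨hj, by omega⟩

end IsDistFrom

/-! ### Cones of growth directions -/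

/-- `C` contains the directions of exactly those neighbors of `x` that are further away from the
root, and no direction of `C` is isolated in `C`. -/
def IsGrowthCone (P : Finset Node) (d : Node → ℕ) (x : Node) (C : Finset (ZMod 6)) : Prop :=
  (∀ j, x + unitVec j ∈ P → (j ∈ C ↔ Up P d x j)) ∧ ∀ k ∈ C, k + 1 ∈ C ∨ k - 1 ∈ C

lemma extendedCone_left {i : ZMod 6} {c : Finset (ZMod 6)} {occ : ZMod 6 → Bool}
    (hc : c = {i - 1, i}) (h2 : occ (i + 2) = false) (h1 : occ (i + 1) = true) :
    extendedCone (some (i + 3), c) occ = {i - 1, i, i + 1, i + 2} := by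
  simp [extendedCone, hc, h2, h1]

lemma pair_ne_pair (i : ZMod 6) : ({i - 1, i} : Finset (ZMod 6)) ≠ {i, i + 1} := by
  revert i; decide

lemma extendedCone_right {i : ZMod 6} {c : Finset (ZMod 6)} {occ : ZMod 6 → Bool}
    (hc : c = {i, i + 1}) (h2 : occ (i - 2) = false) (h1 : occ (i - 1) = true) :
    extendedCone (some (i + 3), c) occ = {i - 2, i - 1, i, i + 1} := by
  simp [extendedCone, hc, h2, h1, (pair_ne_pair i).symm]

lemma extendedCone_of_not {i : ZMod 6} {c : Finset (ZMod 6)} {occ : ZMod 6 → Bool}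
    (hl : ¬ (c = {i - 1, i} ∧ occ (i + 2) = false ∧ occ (i + 1) = true))
    (hr : ¬ (c = {i, i + 1} ∧ occ (i - 2) = false ∧ occ (i - 1) = true)) :
    extendedCone (some (i + 3), c) occ = c := by
  simp only [extendedCone, add_sub_cancel_right, if_neg hl, if_neg hr]

/-- An extended cone has four ports and matches neither two-port pattern. Hence the cone used for
growth does not depend on whether the update has already been stored. -/
lemma extendedCone_idem (m : TreeMemory) (occ : Port → Bool) :
    extendedCone (m.1, extendedCone m occ) occ = extendedCone m occ := by
  obtain ⟨_ | b, c⟩ := m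
  · rfl
  obtain ⟨i, rfl⟩ : ∃ i, b = i + 3 := ⟨b - 3, by ring⟩
  have h4 : ∀ i : ZMod 6, ({i - 1, i, i + 1, i + 2} : Finset (ZMod 6)) ≠ {i - 1, i} ∧
      ({i - 1, i, i + 1, i + 2} : Finset (ZMod 6)) ≠ {i, i + 1} ∧
      ({i - 2, i - 1, i, i + 1} : Finset (ZMod 6)) ≠ {i - 1, i} ∧
      ({i - 2, i - 1, i, i + 1} : Finset (ZMod 6)) ≠ {i, i + 1} := by decide
  by_cases hl : c = {i - 1, i} ∧ occ (i + 2) = false ∧ occ (i + 1) = true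
  · rw [extendedCone_left hl.1 hl.2.1 hl.2.2]
    exact extendedCone_of_not (fun h => (h4 i).1 h.1) fun h => (h4 i).2.1 h.1
  by_cases hr : c = {i, i + 1} ∧ occ (i - 2) = false ∧ occ (i - 1) = true
  · rw [extendedCone_right hr.1 hr.2.1 hr.2.2]
    exact extendedCone_of_not (fun h => (h4 i).2.2.1 h.1) fun h => (h4 i).2.2.2 h.1
  · rw [extendedCone_of_not hl hr, extendedCone_of_not hl hr]

lemma PortLabelling.dir_eq (M : PortLabelling) :
    (∀ k, M.dir k = M.dir 0 + k) ∨ ∀ k, M.dir k = M.dir 0 - k := by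
  rcases M.ordered with h | h
  · left
    have : ∀ n : ℕ, M.dir n = M.dir 0 + n := by
      intro n
      induction n with
      | zero => simp
      | succ n ih => rw [Nat.cast_succ, h, ih, add_assoc]
    intro k
    have := this k.val
    rwa [ZMod.natCast_zmod_val] at this
  · right
    have : ∀ n : ℕ, M.dir n = M.dir 0 - n := by
      intro n
      induction n with
      | zero => simp
      | succ n ih => rw [Nat.cast_succ, h, ih, sub_sub]
    intro k
    have := this k.val
    rwa [ZMod.natCast_zmod_val] at this

lemma PortLabelling.dir_add_three (M : PortLabelling) (k : Port) : M.dir (k + 3) = M.dir k + 3 := by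
  rcases M.dir_eq with h | h
  · rw [h, h k, add_assoc]
  · rw [h, h k, ← sub_sub, sub_eq_add_neg _ (3 : ZMod 6)]
    rfl

/-- The tree memory with ports replaced by global directions. -/
def globalMemory (M : PortLabelling) (m : TreeMemory) : TreeMemory :=
  (m.1.map M.dir, m.2.image M.dir)

/-- The cone extension does not depend on the labelling of the ports. -/
lemma image_extendedCone (M : PortLabelling) (m : TreeMemory) (occ : ZMod 6 → Bool) :
    (extendedCone m fun k => occ (M.dir k)).image M.dir =
      extendedCone (globalMemory M m) occ := by
  obtain ⟨_ | b, c⟩ := m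
  · rfl
  obtain ⟨i, rfl⟩ : ∃ i, b = i + 3 := ⟨b - 3, by ring⟩
  have hg : globalMemory M (some (i + 3), c) = (some (M.dir i + 3), c.image M.dir) := by
    simp [globalMemory, M.dir_add_three]
  have himg : ∀ s : Finset (ZMod 6), c.image M.dir = s.image M.dir ↔ c = s := fun s =>
    (Finset.image_injective M.dir.injective).eq_iff
  rw [hg]
  rcases M.dir_eq with h | h
  · have a1 : M.dir (i + 1) = M.dir i + 1 := by rw [h, h i]; ring
    have a2 : M.dir (i + 2) = M.dir i + 2 := by rw [h, h i]; ring
    have b1 : M.dir (i - 1) = M.dir i - 1 := by rw [h, h i]; ring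
    have b2 : M.dir (i - 2) = M.dir i - 2 := by rw [h, h i]; ring
    have p1 : c.image M.dir = {M.dir i - 1, M.dir i} ↔ c = {i - 1, i} := by
      rw [← himg]; simp [b1]
    have p2 : c.image M.dir = {M.dir i, M.dir i + 1} ↔ c = {i, i + 1} := by
      rw [← himg]; simp [a1]
    by_cases hl : c = {i - 1, i} ∧ occ (M.dir i + 2) = false ∧ occ (M.dir i + 1) = true
    · rw [extendedCone_left hl.1 (by rw [a2]; exact hl.2.1) (by rw [a1]; exact hl.2.2),
        extendedCone_left (p1.2 hl.1) hl.2.1 hl.2.2]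
      simp [a1, a2, b1]
    by_cases hr : c = {i, i + 1} ∧ occ (M.dir i - 2) = false ∧ occ (M.dir i - 1) = true
    · rw [extendedCone_right hr.1 (by rw [b2]; exact hr.2.1) (by rw [b1]; exact hr.2.2),
        extendedCone_right (p2.2 hr.1) hr.2.1 hr.2.2]
      simp [a1, b2, b1]
    · rw [extendedCone_of_not (by rwa [a1, a2]) (by rwa [b1, b2]),
        extendedCone_of_not (by rwa [p1]) (by rwa [p2])]
  -- A clockwise labelling interchanges the two extension rules.
  · have a1 : M.dir (i + 1) = M.dir i - 1 := by rw [h, h i]; ring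
    have a2 : M.dir (i + 2) = M.dir i - 2 := by rw [h, h i]; ring
    have b1 : M.dir (i - 1) = M.dir i + 1 := by rw [h, h i]; ring
    have b2 : M.dir (i - 2) = M.dir i + 2 := by rw [h, h i]; ring
    have p1 : c.image M.dir = {M.dir i - 1, M.dir i} ↔ c = {i, i + 1} := by
      rw [← himg, Finset.pair_comm]; simp [a1]
    have p2 : c.image M.dir = {M.dir i, M.dir i + 1} ↔ c = {i - 1, i} := by
      rw [← himg, Finset.pair_comm]; simp [b1]
    by_cases hl : c = {i - 1, i} ∧ occ (M.dir i - 2) = false ∧ occ (M.dir i - 1) = true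
    · rw [extendedCone_left hl.1 (by rw [a2]; exact hl.2.1) (by rw [a1]; exact hl.2.2),
        extendedCone_right (p2.2 hl.1) hl.2.1 hl.2.2]
      ext j
      simp only [Finset.image_insert, Finset.image_singleton, a1, a2, b1, Finset.mem_insert,
        Finset.mem_singleton]
      tauto
    by_cases hr : c = {i, i + 1} ∧ occ (M.dir i + 2) = false ∧ occ (M.dir i + 1) = true
    · rw [extendedCone_right hr.1 (by rw [b2]; exact hr.2.1) (by rw [b1]; exact hr.2.2),
        extendedCone_left (p1.2 hr.1) hr.2.1 hr.2.2]
      ext j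
      simp only [Finset.image_insert, Finset.image_singleton, a1, b2, b1, Finset.mem_insert,
        Finset.mem_singleton]
      tauto
    · rw [extendedCone_of_not (by rwa [a1, a2]) (by rwa [b1, b2]),
        extendedCone_of_not (by rwa [p1]) (by rwa [p2])]

namespace IsDistFrom

variable {P : Finset Node} {r : Node} {d : Node → ℕ} (hd : IsDistFrom P r d)
include hd

lemma isGrowthCone_root : IsGrowthCone P d r Finset.univ := by
  refine ⟨fun j hj => ⟨fun _ => ⟨hj, ?_⟩, fun _ => Finset.mem_univ _⟩,
    fun k _ => Or.inl (Finset.mem_univ _)⟩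
  have h1 := hd.le_add_one r j hd.root_mem hj
  have h2 : d (r + unitVec j) ≠ 0 := fun h => unitVec_ne_zero j (by
    simpa using hd.eq_root _ hj h)
  have := hd.root
  omega

omit hd in
lemma down_of_up {x : Node} {k : ZMod 6} (hx : x ∈ P) (hk : Up P d x k) :
    Down P d (x + unitVec k) (k + 3) := by
  have e : x + unitVec k + unitVec (k + 3) = x := by rw [unitVec_add_three]; abel
  rw [Down, e]
  exact ⟨hx, hk.2.symm⟩

/-- A common neighbor of `x` and its child is at distance `d x` or `d x + 1`, and membership in `C`
tells which. -/
lemma down_side_iff {x : Node} {C : Finset (ZMod 6)} (hC : IsGrowthCone P d x C) {k j l : ZMod 6}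
    (hx : x ∈ P) (hk : Up P d x k) (e : x + unitVec k + unitVec l = x + unitVec j) :
    Down P d (x + unitVec k) l ↔ x + unitVec j ∈ P ∧ j ∉ C := by
  have hk2 := hk.2
  rw [Down, e]
  constructor
  · rintro ⟨hj, h⟩
    refine ⟨hj, fun hjC => ?_⟩
    have := ((hC.1 j hj).1 hjC).2
    omega
  · rintro ⟨hj, hjC⟩
    refine ⟨hj, ?_⟩
    have h1 := hd.le_add_one x j hx hj
    have h2 := hd.le_add_one' hk.1 (i := l) (by rwa [e])
    rw [e] at h2
    have h3 : d (x + unitVec j) ≠ d x + 1 := fun h => hjC ((hC.1 j hj).2 ⟨hj, h⟩)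
    omega

/-- The cone handed over to a child has the right directions for the child. -/
theorem isGrowthCone_child (hP : HasPotentials P) {x : Node} {C : Finset (ZMod 6)} {k : ZMod 6}
    (hx : x ∈ P) (hC : IsGrowthCone P d x C) (hkC : k ∈ C) (hk : x + unitVec k ∈ P)
    {occ : ZMod 6 → Bool} (hocc : ∀ j, occ j = true ↔ x + unitVec k + unitVec j ∈ P) :
    IsGrowthCone P d (x + unitVec k)
      (extendedCone (some (k + 3), C ∩ {k - 1, k, k + 1}) occ) := by
  have hup := (hC.1 k hk).1 hkC
  have e1 : x + unitVec k + unitVec (k + 2) = x + unitVec (k + 1) := by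
    rw [unitVec_add_two]; abel
  have e2 : x + unitVec k + unitVec (k - 2) = x + unitVec (k - 1) := by
    have : unitVec k + unitVec (k - 2) = unitVec (k - 1) := by
      clear * -; revert k; decide
    rw [add_assoc, this]
  have hD3 := down_of_up hx hup
  have hD1 := hd.down_side_iff hC hx hup e1
  have hD2 := hd.down_side_iff hC hx hup e2
  rw [← e1, ← hocc] at hD1
  rw [← e2, ← hocc] at hD2
  -- Since `x` is closer to the root than the child, `down_adjacent` leaves only the two common
  -- neighbors as further candidates.
  have hD : ∀ j, Down P d (x + unitVec k) j ↔ j = k + 3 ∨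
      (j = k + 2 ∧ occ (k + 2) = true ∧ k + 1 ∉ C) ∨
      (j = k - 2 ∧ occ (k - 2) = true ∧ k - 1 ∉ C) := by
    intro j
    constructor
    · intro h
      rcases hd.down_adjacent hP hk hD3 h with rfl | hj | hj
      · exact Or.inl rfl
      · obtain rfl : j = k - 2 := by rw [hj]; clear * -; revert k; decide
        exact Or.inr (Or.inr ⟨rfl, hD2.1 h⟩)
      · obtain rfl : j = k + 2 := by rw [hj]; clear * -; revert k; decide
        exact Or.inr (Or.inl ⟨rfl, hD1.1 h⟩)
    · rintro (rfl | ⟨rfl, h⟩ | ⟨rfl, h⟩)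
      · exact hD3
      · exact hD1.2 h
      · exact hD2.2 h
  have hUp : ∀ j, x + unitVec k + unitVec j ∈ P → _ := fun j hj => hd.up_iff hP hk hj
  simp only [hD] at hUp
  have hmem : ∀ j, j ∈ C ∩ {k - 1, k, k + 1} ↔
      (j = k - 1 ∧ k - 1 ∈ C) ∨ j = k ∨ (j = k + 1 ∧ k + 1 ∈ C) := by
    intro j
    simp only [Finset.mem_inter, Finset.mem_insert, Finset.mem_singleton]
    constructor
    · rintro ⟨h, rfl | rfl | rfl⟩ <;> simp [h]
    · rintro (⟨rfl, h⟩ | rfl | ⟨rfl, h⟩) <;> simp [*]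
  clear hD hD1 hD2 hD3
  -- If one of `k ± 1` is missing from `C`, the common neighbor there is either occupied, hence
  -- closer, which rules out growth on that side, or empty. In the empty case the side direction
  -- must be added if occupied, which is what the extension does; the empty direction added with it
  -- is harmless.
  by_cases h1 : k + 1 ∈ C <;> by_cases h2 : k - 1 ∈ C
  · have hA : C ∩ {k - 1, k, k + 1} = {k - 1, k, k + 1} := by
      ext j; rw [hmem]; simp [h1, h2]
    have h3 : ∀ k : ZMod 6, ({k - 1, k, k + 1} : Finset (ZMod 6)) ≠ {k - 1, k} ∧
      ({k - 1, k, k + 1} : Finset (ZMod 6)) ≠ {k, k + 1} := by decide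
    rw [hA, extendedCone_of_not (fun h => (h3 k).1 h.1) fun h => (h3 k).2 h.1]
    refine ⟨fun j hj => ?_, ?_⟩
    · rw [hUp j hj]
      simp only [h1, h2, not_true_eq_false, and_false, or_false]
      clear * -
      revert j k; decide
    · clear * -
      revert k; decide
  · have hA : C ∩ {k - 1, k, k + 1} = {k, k + 1} := by
      ext j; rw [hmem]; simp [h1, h2]
    rw [hA]
    simp only [h1, h2, not_true_eq_false, not_false_eq_true, and_false, and_true, false_or] at hUp
    by_cases o2 : occ (k - 2) = true
    · rw [extendedCone_of_not (fun h => pair_ne_pair k h.1.symm) fun h => by simp [o2] at h]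
      refine ⟨fun j hj => ?_, ?_⟩
      · rw [hUp j hj]
        simp only [o2, and_true]
        clear * -
        revert j k; decide
      · clear * -
        revert k; decide
    have hne2 : ∀ j, x + unitVec k + unitVec j ∈ P → j ≠ k - 2 := by
      rintro j hj rfl; exact o2 ((hocc _).2 hj)
    by_cases o1 : occ (k - 1) = true
    · rw [extendedCone_right rfl (by simpa using o2) o1]
      refine ⟨fun j hj => ?_, ?_⟩
      · rw [hUp j hj]
        have := hne2 j hj
        simp only [o2]
        clear * - this
        revert j k; decide
      · clear * -
        revert k; decide
    · have hne1 : ∀ j, x + unitVec k + unitVec j ∈ P → j ≠ k - 1 := by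
        rintro j hj rfl; exact o1 ((hocc _).2 hj)
      rw [extendedCone_of_not (fun h => pair_ne_pair k h.1.symm) fun h => o1 h.2.2]
      refine ⟨fun j hj => ?_, ?_⟩
      · rw [hUp j hj]
        have h1 := hne1 j hj
        have h2 := hne2 j hj
        simp only [o2]
        clear * - h1 h2
        revert j k; decide
      · clear * -
        revert k; decide
  · have hA : C ∩ {k - 1, k, k + 1} = {k - 1, k} := by
      ext j; rw [hmem]; simp [h1, h2]
    rw [hA]
    simp only [h1, h2, not_true_eq_false, not_false_eq_true, and_false, and_true, or_false] at hUp
    by_cases o2 : occ (k + 2) = true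
    · rw [extendedCone_of_not (fun h => by simp [o2] at h) fun h => pair_ne_pair k h.1]
      refine ⟨fun j hj => ?_, ?_⟩
      · rw [hUp j hj]
        simp only [o2, and_true]
        clear * -
        revert j k; decide
      · clear * -
        revert k; decide
    have hne2 : ∀ j, x + unitVec k + unitVec j ∈ P → j ≠ k + 2 := by
      rintro j hj rfl; exact o2 ((hocc _).2 hj)
    by_cases o1 : occ (k + 1) = true
    · rw [extendedCone_left rfl (by simpa using o2) o1]
      refine ⟨fun j hj => ?_, ?_⟩
      · rw [hUp j hj]
        have := hne2 j hj
        simp only [o2]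
        clear * - this
        revert j k; decide
      · clear * -
        revert k; decide
    · have hne1 : ∀ j, x + unitVec k + unitVec j ∈ P → j ≠ k + 1 := by
        rintro j hj rfl; exact o1 ((hocc _).2 hj)
      rw [extendedCone_of_not (fun h => o1 h.2.2) fun h => pair_ne_pair k h.1]
      refine ⟨fun j hj => ?_, ?_⟩
      · rw [hUp j hj]
        have h1 := hne1 j hj
        have h2 := hne2 j hj
        simp only [o2]
        clear * - h1 h2
        revert j k; decide
      · clear * -
        revert k; decide
  -- The extension rules do not act on the one-element cone `{k}`; this is why `IsGrowthCone`
  -- forbids isolated directions.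
  · rcases hC.2 k hkC with h | h <;> contradiction

end IsDistFrom

/-! ### Single steps of the cone algorithm -/

lemma neighbor_eq_some {P : Finset Node} {p q : Particle P} {i : ZMod 6} :
    neighbor p i = some q ↔ q.1 = p.1 + unitVec i := by
  unfold neighbor
  split_ifs with h
  · rw [Option.some_inj, eq_comm, Subtype.ext_iff]
  · simp only [false_iff]
    intro h'
    exact h (h' ▸ q.2)

/-- Whether the neighboring node in direction `i` is occupied. -/
def occupied {P : Finset Node} (p : Particle P) (i : ZMod 6) : Bool := (neighbor p i).isSome

lemma occupied_iff {P : Finset Node} {p : Particle P} {i : ZMod 6} :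
    occupied p i = true ↔ p.1 + unitVec i ∈ P := by
  unfold occupied neighbor
  split_ifs with h <;> simp [h]

section Step

variable {P : Finset Node} {L : Particle P → PortLabelling} {S : Set (Particle P)}
  {c c' : Memory coneAlgorithm P}

lemma view_isSome (p : Particle P) (k : Port) :
    (view coneAlgorithm L c p k).isSome = occupied p ((L p).dir k) := by
  simp [view, occupied]

/-- The cone from which the particle `p` with memory `m` grows when activated. -/
def growthCone (L : Particle P → PortLabelling) (p : Particle P) (m : TreeMemory) : Finset Port :=
  extendedCone m fun k => occupied p ((L p).dir k)

lemma writes_iff {p q : Particle P} {s : Option TreeMemory} :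
    Writes coneAlgorithm L c p q s ↔ ∃ m, c p = some m ∧
      ((p = q ∧ s = some (m.1, growthCone L p m)) ∨
        ∃ k ∈ growthCone L p m, neighbor p ((L p).dir k) = some q ∧ c q = none ∧
          s = some (childMemory (growthCone L p m) k ((L p).dir.trans (L q).dir.symm))) := by
  have hact : ∀ m : TreeMemory, coneAlgorithm.act (some m) (view coneAlgorithm L c p) =
      (some (some (m.1, growthCone L p m)), fun k =>
          match view coneAlgorithm L c p k with
          | some (none, tr) => if k ∈ growthCone L p m then
              some (some (childMemory (growthCone L p m) k tr)) else none
          | _ => none) := by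
    intro m
    simp only [growthCone, ← view_isSome (c := c)]
    rfl
  have hnone : coneAlgorithm.act none (view coneAlgorithm L c p) = (none, fun _ => none) := rfl
  unfold Writes
  rcases hcp : c p with _ | m
  · rw [hnone]
    simp
  · rw [hact]
    constructor
    · rintro (⟨rfl, h⟩ | ⟨k, hk, h⟩)
      · exact ⟨m, rfl, Or.inl ⟨rfl, (Option.some_inj.1 h).symm⟩⟩
      · refine ⟨m, rfl, Or.inr ⟨k, ?_⟩⟩
        have hv : view coneAlgorithm L c p k = some (c q, (L p).dir.trans (L q).dir.symm) := by
          simp [view, hk]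
        simp only [hv] at h
        rcases hcq : c q with _ | m'
        · simp only [hcq] at h
          split_ifs at h with hkm
          exact ⟨hkm, hk, rfl, (Option.some_inj.1 h).symm⟩
        · simp only [hcq] at h
          exact absurd h (by simp)
    · rintro ⟨m', hm', h⟩
      obtain rfl := Option.some_inj.1 hm'
      rcases h with ⟨rfl, rfl⟩ | ⟨k, hkm, hk, hcq, rfl⟩
      · exact Or.inl ⟨rfl, rfl⟩
      · refine Or.inr ⟨k, hk, ?_⟩
        have hv : view coneAlgorithm L c p k = some (none, (L p).dir.trans (L q).dir.symm) := by
          simp only [view, hk, Option.map_some]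
          rw [hcq]
          rfl
        simp only [hv, if_pos hkm]

/-- Others write only into particles outside the tree, so a particle of the tree can be changed only
by its own cone update. -/
lemma Step.eq_of_some (h : Step coneAlgorithm L S c c') {q : Particle P} {m : TreeMemory}
    (hq : c q = some m) : c' q = some m ∨ c' q = some (m.1, growthCone L q m) := by
  rcases h q with ⟨p, -, hw⟩ | ⟨-, h⟩
  · obtain ⟨m', hm', ⟨rfl, h⟩ | ⟨k, -, -, hn, -⟩⟩ := writes_iff.1 hw
    · obtain rfl := Option.some_inj.1 (hq.symm.trans hm')
      exact Or.inr h
    · exact absurd (hq.symm.trans hn) (by simp)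
  · exact Or.inl (h.trans hq)

lemma Step.eq_childMemory (h : Step coneAlgorithm L S c c') {q : Particle P} {m' : TreeMemory}
    (hq : c q = none) (hq' : c' q = some m') :
    ∃ p m k, c p = some m ∧ k ∈ growthCone L p m ∧ neighbor p ((L p).dir k) = some q ∧
      m' = childMemory (growthCone L p m) k ((L p).dir.trans (L q).dir.symm) := by
  rcases h q with ⟨p, -, hw⟩ | ⟨-, h⟩
  · obtain ⟨m, hm, ⟨rfl, -⟩ | ⟨k, hk, hpq, -, h⟩⟩ := writes_iff.1 hw
    · exact absurd (hq.symm.trans hm) (by simp)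
    · exact ⟨p, m, k, hm, hk, hpq, Option.some_inj.1 (hq'.symm.trans h)⟩
  · exact absurd (hq'.symm.trans (h.trans hq)) (by simp)

/-- When several particles compete for `q`, whichever write succeeds includes it. -/
lemma Step.exists_eq_some (h : Step coneAlgorithm L S c c') {p q : Particle P} (hp : p ∈ S)
    {m : TreeMemory} (hm : c p = some m) {k : Port} (hk : k ∈ growthCone L p m)
    (hpq : neighbor p ((L p).dir k) = some q) : ∃ m', c' q = some m' := by
  rcases hcq : c q with _ | m'
  · rcases h q with ⟨p', -, hw⟩ | ⟨h, -⟩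
    · obtain ⟨m', -, ⟨-, h⟩ | ⟨k, -, -, -, h⟩⟩ := writes_iff.1 hw <;> exact ⟨_, h⟩
    · exact absurd (writes_iff.2 ⟨m, hm, Or.inr ⟨k, hk, hpq, hcq, rfl⟩⟩) (h p hp _)
  · rcases h.eq_of_some hcq with h | h <;> exact ⟨_, h⟩

end Step

/-! ### Distances in the particle graph -/

section Distance

variable {P : Finset Node}

lemma particleGraph_adj_iff {p q : Particle P} :
    (particleGraph P).Adj p q ↔ ∃ i, q.1 = p.1 + unitVec i :=
  grid_adj_iff

open scoped Classical in
/-- The distance of a node from the root in the particle graph. -/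
noncomputable def rootDist (r : Particle P) (x : Node) : ℕ :=
  if h : x ∈ P then (particleGraph P).dist ⟨x, h⟩ r else 0

lemma rootDist_particle (r p : Particle P) : rootDist r p.1 = (particleGraph P).dist p r :=
  dif_pos p.2

lemma isDistFrom_rootDist (hc : (particleGraph P).Connected) (r : Particle P) :
    IsDistFrom P r.1 (rootDist r) := by
  have hadj : ∀ p q : Particle P, (particleGraph P).Adj p q →
      (particleGraph P).dist q r ≤ (particleGraph P).dist p r + 1 := by
    intro p q h
    have h1 := hc.dist_triangle (u := q) (v := p) (w := r)
    have h2 := SimpleGraph.dist_eq_one_iff_adj.2 h.symm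
    omega
  constructor
  · exact r.2
  · rw [rootDist_particle, SimpleGraph.dist_self]
  · intro x hx h
    rw [rootDist_particle r ⟨x, hx⟩] at h
    exact congrArg Subtype.val (hc.dist_eq_zero_iff.1 h)
  · intro x i hx hy
    rw [rootDist_particle r ⟨x, hx⟩, rootDist_particle r ⟨_, hy⟩]
    exact hadj _ _ (particleGraph_adj_iff.2 ⟨i, rfl⟩)
  · intro x hx h
    rw [rootDist_particle r ⟨x, hx⟩] at h ⊢
    obtain ⟨w, hw⟩ := hc.exists_walk_length_eq_dist ⟨x, hx⟩ r
    cases w with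
    | nil => exact absurd hw.symm h
    | @cons _ v _ ha w =>
      obtain ⟨i, hi⟩ := particleGraph_adj_iff.1 ha
      refine ⟨i, hi ▸ v.2, ?_⟩
      rw [← hi, rootDist_particle]
      have h1 := SimpleGraph.dist_le w
      have h2 := hadj _ _ ha.symm
      rw [SimpleGraph.Walk.length_cons] at hw
      omega

end Distance

/-! ### Trees given by parent pointers -/

section Tree

variable {P : Finset Node} {r : Particle P} {parent : Particle P → Option (Particle P)}

lemma exists_treeGraph_walk (hc : (particleGraph P).Connected)
    (hpar : ∀ p, p ≠ r → ∃ q, parent p = some q ∧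
      (particleGraph P).dist q r + 1 = (particleGraph P).dist p r) (p : Particle P) :
    ∃ w : (treeGraph parent).Walk p r, w.length = (particleGraph P).dist p r := by
  generalize hn : (particleGraph P).dist p r = n
  induction n generalizing p with
  | zero =>
    obtain rfl := hc.dist_eq_zero_iff.1 hn
    exact ⟨.nil, rfl⟩
  | succ n ih =>
    have hpr : p ≠ r := by
      rintro rfl
      rw [SimpleGraph.dist_self] at hn
      omega
    obtain ⟨q, hq, hd⟩ := hpar p hpr
    obtain ⟨w, hw⟩ := ih q (by omega)
    have hadj : (treeGraph parent).Adj p q := by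
      refine ⟨?_, Or.inl hq⟩
      rintro rfl
      omega
    exact ⟨.cons hadj w, by rw [SimpleGraph.Walk.length_cons, hw]⟩

lemma isSPTree_of_parent (hc : (particleGraph P).Connected) (hr : parent r = none)
    (hpar : ∀ p, p ≠ r → ∃ q, parent p = some q ∧ (particleGraph P).Adj p q ∧
      (particleGraph P).dist q r + 1 = (particleGraph P).dist p r) : IsSPTree P r parent := by
  have hwalk := exists_treeGraph_walk hc fun p hp =>
    let ⟨q, h1, _, h2⟩ := hpar p hp
    ⟨q, h1, h2⟩
  have hpar' : ∀ p q, parent p = some q → (particleGraph P).Adj p q := by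
    intro p q h
    have hpr : p ≠ r := by rintro rfl; rw [hr] at h; cases h
    obtain ⟨q', hq', ha, -⟩ := hpar p hpr
    obtain rfl := Option.some_inj.1 (h.symm.trans hq')
    exact ha
  have hsub : treeGraph parent ≤ particleGraph P := by
    rintro p q ⟨-, h | h⟩
    · exact hpar' p q h
    · exact (hpar' q p h).symm
  have hconn : (treeGraph parent).Connected := by
    have : Nonempty (Particle P) := ⟨r⟩
    refine SimpleGraph.Connected.mk fun p q => ?_
    exact (hwalk p).choose.reachable.trans (hwalk q).choose.reachable.symm
  have htree : (treeGraph parent).IsTree := by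
    rw [SimpleGraph.isTree_iff_connected_and_card]
    refine ⟨hconn, le_antisymm ?_ hconn.card_vert_le_card_edgeSet_add_one⟩
    have hcard : Nat.card {p : Particle P // p ≠ r} + 1 = Nat.card (Particle P) := by
      classical
      rw [Nat.card_eq_fintype_card, Nat.card_eq_fintype_card, Fintype.card_subtype_compl,
        Fintype.card_subtype_eq]
      have : 0 < Fintype.card (Particle P) := Fintype.card_pos_iff.2 ⟨r⟩
      omega
    rw [← hcard, Nat.add_le_add_iff_right]
    -- An edge is determined by its child end, so there are at most as many edges as particles other
    -- than the root.
    have hedge : ∀ e : (treeGraph parent).edgeSet, ∃ p : {p : Particle P // p ≠ r}, ∃ q,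
        parent p = some q ∧ e.1 = s(p.1, q) := by
      have aux : ∀ p q, parent p = some q → p ≠ r := by
        rintro p q h rfl
        rw [hr] at h
        cases h
      rintro ⟨e, he⟩
      induction e with
      | _ p q =>
        obtain ⟨-, h | h⟩ := SimpleGraph.mem_edgeSet _ |>.1 he
        · exact ⟨⟨p, aux p q h⟩, q, h, rfl⟩
        · exact ⟨⟨q, aux q p h⟩, p, h, Sym2.eq_swap⟩
    choose f g hfg hf using hedge
    refine Nat.card_le_card_of_injective f fun e e' h => ?_
    have : g e = g e' := Option.some_inj.1 ((hfg e).symm.trans (h ▸ hfg e'))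
    exact Subtype.ext (by rw [hf, hf, h, this])
  refine ⟨hr, fun p hp h => ?_, hsub, htree, fun p w hw => ?_⟩
  · obtain ⟨q, hq, -⟩ := hpar p hp
    rw [hq] at h
    cases h
  · obtain ⟨w', hw'⟩ := hwalk p
    classical
    have heq : (⟨w, hw⟩ : (treeGraph parent).Path p r) = w'.toPath :=
      (htree.isAcyclic.subsingleton_path _ _).elim _ _
    have h1 : w.length ≤ w'.length := by
      have := congrArg (fun p => p.1.length) heq
      exact this.trans_le (SimpleGraph.Walk.length_bypass_le_length w')
    have h2 := SimpleGraph.dist_le (w.mapLe hsub)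
    rw [SimpleGraph.Walk.length_map] at h2
    omega

end Tree

/-! ### Rounds -/

/-- Fairness and finiteness make the set in `roundEnd` nonempty, so its infimum is attained and is
not the default 0. -/
lemma exists_active_of_round {P : Finset Node} {active : ℕ → Set (Particle P)}
    (hfair : Fair active) (k : ℕ) (p : Particle P) :
    ∃ s, roundEnd active k ≤ s ∧ s < roundEnd active (k + 1) ∧ p ∈ active s := by
  have hne : {t | ∀ p, ∃ s, roundEnd active k ≤ s ∧ s < t ∧ p ∈ active s}.Nonempty := by
    choose f hf using hfair (roundEnd active k)
    refine ⟨Finset.univ.sup f + 1, fun p => ⟨f p, (hf p).1.le, ?_, (hf p).2⟩⟩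
    exact Nat.lt_succ_of_le (Finset.le_sup (Finset.mem_univ p))
  exact Nat.sInf_mem hne p

/-! ### The tree that the cone algorithm builds -/

section Run

variable {P : Finset Node} {L : Particle P → PortLabelling}

/-- The tree built so far: the root keeps its initial memory, the parent of any other particle of
the tree is closer to the root, and every particle of the tree grows in the directions away from
the root. -/
structure TreeInvariant (L : Particle P → PortLabelling) (r : Particle P) (d : Node → ℕ)
    (c : Memory coneAlgorithm P) : Prop where
  root : c r = some (none, Finset.univ)
  parent : ∀ p, p ≠ r → ∀ m, c p = some m → ∃ b, m.1 = some b ∧ Down P d p.1 ((L p).dir b)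
  cone : ∀ p m, c p = some m → IsGrowthCone P d p.1 ((growthCone L p m).image (L p).dir)

variable {r : Particle P} {d : Node → ℕ} {c c' : Memory coneAlgorithm P}

lemma treeInvariant_initialMemory (hd : IsDistFrom P r.1 d) :
    TreeInvariant L r d (initialMemory r) := by
  have hnone : ∀ p, p ≠ r → initialMemory r p = none := fun p hp => if_neg hp
  have hroot : initialMemory r r = some (none, Finset.univ) := if_pos rfl
  refine ⟨hroot, fun p hp m hm => ?_, fun p m hm => ?_⟩
  · exact absurd (hm.symm.trans (hnone p hp)) (by simp)
  · by_cases hp : p = r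
    · subst hp
      obtain rfl := Option.some_inj.1 (hm.symm.trans hroot)
      have : growthCone L p (none, Finset.univ) = Finset.univ := rfl
      rw [this, Finset.image_univ_equiv]
      exact hd.isGrowthCone_root
    · exact absurd (hm.symm.trans (hnone p hp)) (by simp)

lemma PortLabelling.image_triple (M : PortLabelling) (k : Port) :
    ({k - 1, k, k + 1} : Finset Port).image M.dir = {M.dir k - 1, M.dir k, M.dir k + 1} := by
  rw [Finset.image_insert, Finset.image_insert, Finset.image_singleton]
  rcases M.dir_eq with h | h
  · rw [show M.dir (k - 1) = M.dir k - 1 by rw [h, h k]; ring,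
      show M.dir (k + 1) = M.dir k + 1 by rw [h, h k]; ring]
  · rw [show M.dir (k - 1) = M.dir k + 1 by rw [h, h k]; ring,
      show M.dir (k + 1) = M.dir k - 1 by rw [h, h k]; ring]
    ext j
    simp only [Finset.mem_insert, Finset.mem_singleton]
    tauto

/-- Translating into the ports of the child and reading them as directions cancels `N`, so the cones
can be analysed in global directions only. -/
lemma globalMemory_childMemory (M N : PortLabelling) (cone : Finset Port) (k : Port) :
    globalMemory N (childMemory cone k (M.dir.trans N.dir.symm)) =
      (some (M.dir k + 3),
        cone.image M.dir ∩ {M.dir k - 1, M.dir k, M.dir k + 1}) := by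
  have hcomp : N.dir ∘ (M.dir.trans N.dir.symm) = M.dir := by
    ext j; simp
  rw [globalMemory, childMemory, Finset.image_image, hcomp,
    Finset.image_inter _ _ M.dir.injective, M.image_triple]
  simp [M.dir_add_three]

/-- A new particle is covered by `isGrowthCone_child` whichever parent won; an old one keeps its
parent port and, by `extendedCone_idem`, its growth cone. -/
lemma TreeInvariant.step (hd : IsDistFrom P r.1 d) (hP : HasPotentials P)
    {S : Set (Particle P)} (hc : TreeInvariant L r d c) (h : Step coneAlgorithm L S c c') :
    TreeInvariant L r d c' := by
  have key : ∀ q m', c' q = some m' → (q ≠ r → ∃ b, m'.1 = some b ∧ Down P d q.1 ((L q).dir b)) ∧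
      IsGrowthCone P d q.1 ((growthCone L q m').image (L q).dir) := by
    intro q m' hm'
    rcases hcq : c q with _ | m
    · obtain ⟨p, m, k, hm, hk, hpq, rfl⟩ := h.eq_childMemory hcq hm'
      have hpq' := neighbor_eq_some.1 hpq
      have hC := hc.cone p m hm
      have hkC := Finset.mem_image_of_mem (L p).dir hk
      have hmem : p.1 + unitVec ((L p).dir k) ∈ P := hpq' ▸ q.2
      have hglob := globalMemory_childMemory (L p) (L q) (growthCone L p m) k
      constructor
      · intro _
        refine ⟨_, rfl, ?_⟩
        have : (L q).dir ((L p).dir.trans (L q).dir.symm (k + 3)) = (L p).dir k + 3 := by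
          simp [PortLabelling.dir_add_three]
        rw [this, hpq']
        exact IsDistFrom.down_of_up p.2 ((hC.1 _ hmem).1 hkC)
      · rw [growthCone, image_extendedCone, hglob, hpq']
        exact hd.isGrowthCone_child hP p.2 hC hkC hmem fun j => by
          rw [occupied_iff, hpq']
    · have hfst : m'.1 = m.1 ∧ growthCone L q m' = growthCone L q m := by
        rcases h.eq_of_some hcq with h | h
        · obtain rfl := Option.some_inj.1 (hm'.symm.trans h)
          exact ⟨rfl, rfl⟩
        · obtain rfl := Option.some_inj.1 (hm'.symm.trans h)
          exact ⟨rfl, extendedCone_idem _ _⟩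
      rw [hfst.1, hfst.2]
      exact ⟨fun hq => hc.parent q hq m hcq, hc.cone q m hcq⟩
  refine ⟨?_, fun q hq m hm => (key q m hm).1 hq, fun q m hm => (key q m hm).2⟩
  rcases h.eq_of_some hc.root with h | h <;> exact h

lemma Step.parentOf_eq {S : Set (Particle P)} (h : Step coneAlgorithm L S c c') {p : Particle P}
    {m : TreeMemory} (hm : c p = some m) : parentOf L c' p = parentOf L c p := by
  have hval : ∀ (c : Memory coneAlgorithm P) (m : TreeMemory), c p = some m →
      parentOf L c p = m.1.bind fun b => neighbor p ((L p).dir b) := by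
    intro c m hm
    obtain ⟨_ | b, s⟩ := m <;> simp only [parentOf, hm] <;> rfl
  rcases h.eq_of_some hm with h | h
  · rw [hval c m hm, hval c' _ h]
  · rw [hval c m hm, hval c' _ h]

lemma TreeInvariant.isSPTree (hconn : (particleGraph P).Connected)
    (hc : TreeInvariant L r (rootDist r) c) (hall : ∀ p, ∃ m, c p = some m) :
    IsSPTree P r (parentOf L c) := by
  refine isSPTree_of_parent hconn ?_ fun p hp => ?_
  · simp only [parentOf, hc.root]
  · obtain ⟨⟨b', s⟩, hm⟩ := hall p
    obtain ⟨b, hb, hmem, hdist⟩ := hc.parent p hp _ hm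
    obtain rfl : b' = some b := hb
    refine ⟨⟨_, hmem⟩, ?_, particleGraph_adj_iff.2 ⟨_, rfl⟩, ?_⟩
    · simp only [parentOf, hm]
      exact neighbor_eq_some.2 rfl
    · rwa [rootDist_particle r ⟨_, hmem⟩, rootDist_particle] at hdist

variable {active : ℕ → Set (Particle P)} {run : ℕ → Memory coneAlgorithm P}

lemma exists_eq_some_of_le (hrun : IsRun coneAlgorithm L active (initialMemory r) run)
    {p : Particle P} {s t : ℕ} (hst : s ≤ t) (h : ∃ m, run s p = some m) :
    ∃ m, run t p = some m := by
  induction t, hst using Nat.le_induction with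
  | base => exact h
  | succ t _ ih =>
    obtain ⟨m, hm⟩ := ih
    rcases (hrun.2 t).eq_of_some hm with h | h <;> exact ⟨_, h⟩

lemma treeInvariant_run (hd : IsDistFrom P r.1 d) (hP : HasPotentials P)
    (hrun : IsRun coneAlgorithm L active (initialMemory r) run) (t : ℕ) :
    TreeInvariant L r d (run t) := by
  induction t with
  | zero => rw [hrun.1]; exact treeInvariant_initialMemory hd
  | succ t ih => exact ih.step hd hP (hrun.2 t)

/-- After `k` rounds, all particles within distance `k` from the root are in the tree. -/
lemma exists_eq_some_of_roundEnd (hd : IsDistFrom P r.1 d) (hP : HasPotentials P)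
    (hfair : Fair active) (hrun : IsRun coneAlgorithm L active (initialMemory r) run) (k : ℕ)
    (p : Particle P) (hpk : d p.1 ≤ k) : ∃ m, run (roundEnd active k) p = some m := by
  induction k generalizing p with
  | zero =>
    obtain rfl : p = r := Subtype.ext (hd.eq_root _ p.2 (by omega))
    exact ⟨_, (treeInvariant_run hd hP hrun _).root⟩
  | succ k ih =>
    have hround := exists_active_of_round hfair k
    by_cases hpk' : d p.1 ≤ k
    · obtain ⟨s, h1, h2, -⟩ := hround p
      exact exists_eq_some_of_le hrun (by omega) (ih p hpk')
    · obtain ⟨i, hi, hi'⟩ := hd.exists_down p.1 p.2 (by omega)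
      obtain ⟨q, hq⟩ : ∃ q : Particle P, q.1 = p.1 + unitVec i := ⟨⟨_, hi⟩, rfl⟩
      rw [← hq] at hi'
      -- The neighbor `q` closer to the root is in the tree when it is activated in this round, and
      -- its cone contains `p`. Even if `p` gets another parent, it is in the tree by time `s + 1`.
      obtain ⟨s, h1, h2, hs⟩ := hround q
      obtain ⟨m, hm⟩ := exists_eq_some_of_le hrun h1 (ih q (by omega))
      have hC := (treeInvariant_run hd hP hrun s).cone q m hm
      have e : p.1 = q.1 + unitVec (i + 3) := by rw [hq, unitVec_add_three]; abel
      have hmem : q.1 + unitVec (i + 3) ∈ P := e ▸ p.2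
      have hup : Up P d q.1 (i + 3) := ⟨hmem, by rw [← e]; exact hi'.symm⟩
      obtain ⟨k', hk', hdir⟩ := Finset.mem_image.1 ((hC.1 _ hmem).2 hup)
      refine exists_eq_some_of_le hrun (s := s + 1) (by omega) ?_
      refine (hrun.2 s).exists_eq_some hs hm hk' ?_
      rw [hdir]
      exact neighbor_eq_some.2 e

end Run

end Amoebot

theorem mainTheorem4 :
    ∃ C : ℕ, ∀ (P : Finset Amoebot.Node) (r : Amoebot.Particle P)
      (L : Amoebot.Particle P → Amoebot.PortLabelling)
      (active : ℕ → Set (Amoebot.Particle P))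
      (c : ℕ → Amoebot.Memory Amoebot.coneAlgorithm P),
      Amoebot.SimplyConnected P →
      Amoebot.Fair active →
      Amoebot.IsRun Amoebot.coneAlgorithm L active (Amoebot.initialMemory r) c →
      ∃ parent : Amoebot.Particle P → Option (Amoebot.Particle P),
        Amoebot.IsSPTree P r parent ∧
        ∀ t, Amoebot.roundEnd active (C * (Amoebot.particleGraph P).diam) ≤ t →
          Amoebot.parentOf L (c t) = parent := by
  -- Each round gains one unit of distance, so the diameter itself bounds the number of rounds.
  refine ⟨1, fun P r L active c hsc hfair hrun => ?_⟩
  obtain ⟨hconn, hholes⟩ := hsc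
  have hP := Amoebot.hasPotentials_of_forall_not_isHole hholes
  have hd := Amoebot.isDistFrom_rootDist hconn r
  set T := Amoebot.roundEnd active (1 * (Amoebot.particleGraph P).diam) with hT
  have hall : ∀ p, ∃ m, c T p = some m := by
    intro p
    refine Amoebot.exists_eq_some_of_roundEnd hd hP hfair hrun _ p ?_
    rw [Amoebot.rootDist_particle, one_mul]
    have : Nonempty (Amoebot.Particle P) := ⟨r⟩
    exact SimpleGraph.dist_le_diam (SimpleGraph.connected_iff_ediam_ne_top.1 hconn)
  refine ⟨Amoebot.parentOf L (c T),
    (Amoebot.treeInvariant_run hd hP hrun T).isSPTree hconn hall, fun t ht => ?_⟩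
  induction t, ht using Nat.le_induction with
  | base => rfl
  | succ t ht ih =>
    rw [← ih]
    funext p
    obtain ⟨m, hm⟩ := Amoebot.exists_eq_some_of_le hrun ht (hall p)
    exact (hrun.2 t).parentOf_eq hm
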